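/- **Market.** Buyers $N=\{1,\dots,n\}$ and sellers $M=\{1,\dots,m\}$ ($n,m\ge 1$) form a bipartite graph with edge set $E\subseteq N\times M$; $E_i$ and $E_j$ are the edges at buyer $i$ and at seller $j$. Seller $j$ owns divisible goods constrained by a polymatroid $P_j=\{w\in\mathbb R_+^{E_j}: w(F)\le f_j(F)\ \forall F\subseteq E_j\}$, where $f_j:2^{E_j}\to\mathbb R_+$ is monotone, submodular, $f_j(\emptyset)=0$; $f_j(E_j)$ is her total supply, and $P=\bigoplus_{j} P_j$. Buyer $i$ has valuation $v_i>0$ per unit and budget $B_i\in[0,\infty]$; seller $j$ has valuation $\rho_j>0$ per unit. An allocation $\mathcal A=(w,p,r)$ consists of nonnegative transactions $w$ on $E$, payments $p$ of buyers and revenues $r$ of sellers; it is feasible if $w\in P$ and $p_i\le B_i$ for all $i$. Put $$\mathrm{SW}(\mathcal A)=\sum_{i\in N}v_i\,w(E_i)+\sum_{j\in M}\rho_j\bigl(f_j(E_j)-w(E_j)\bigr),\qquad \mathrm{LW}(\mathcal A)=\sum_{i\in N}\min(v_i\,w(E_i),B_i)+\sum_{j\in M}\rho_j\bigl(f_j(E_j)-w(E_j)\bigr),$$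 and let $\mathrm{LW}^{\mathrm{OPT}(\rho)}$ be the maximum of $\mathrm{LW}$ over feasible allocations when the sellers' valuations are $\rho$. **Polyhedral Clinching Auction** (bids $v$ of buyers, $\rho'$ of sellers, increment $\varepsilon>0$). For each seller $j$ add a virtual buyer $n+j$, adjacent only to $j$, with bid $\rho'_j$ and budget $\infty$, and set $f_j(F)=f_j(E_j)$ for every $F$ containing her edge; from here on $N$, $E$, $P$, $v$ refer to the enlarged market. Start with all price clocks $c_i=0$, demands $d_i=\infty$, $w=p=r=0$, and $l$ the first buyer (original buyers come first, then the virtual ones, in order of index). While some $d_i\ne0$: (1) for each buyer $i$ in order, let $\xi_i$ be a maximal vector of the clinching polytope $\{\xi\in\mathbb R_+^{E_i}: P^i_{w,d}(\xi)=P^i_{w,d}(0)\}$, where $P^i_{w,d}(\xi)=\{(y(E_k))_{k\ne i}: y\in\mathbb R_+^E,\ w+y\in P,\ y(E_k)\le d_k\ \forall k,\ y|_{E_i}=\xi\}$; add $\xi_i$ to $w$ on $E_i$, add $c_i\xi_i(E_i)$ to $p_i$, add $c_i\xi_{ij}$ to $r_j$ for each $ij\in E_i$, and update $d_i$; (2)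 increase $c_l$ by $\varepsilon$, update $d_l$, and let $l$ be the next buyer cyclically. Here updating means $d_i:=(B_i-p_i)/c_i$ if $c_i<v_i$ (read as $\infty$ if $c_i=0$) and $d_i:=0$ if $c_i\ge v_i$. At the end the transactions and payments of the virtual buyers are cancelled, the revenue of seller $j$ becoming $r_j-p_{n+j}$. **Mechanism $\mathbb M(\rho,\rho^s)$** (sellers' valuations $\rho$, reported truthfully, and samples $\rho^s$). Let $\tilde M=\{j:\rho^s_j\ge\rho_j\}$; run the Polyhedral Clinching Auction on the market restricted to the sellers in $\tilde M$, with seller bids $(\rho^s_j)_{j\in\tilde M}$. Transactions and payments of the buyers are the resulting ones; sellers outside $\tilde M$ trade nothing and get $0$, and each $j\in\tilde M$ receives $\rho^s_j$ per unit sold. $\mathrm{SW}^{\mathbb M(\rho,\rho^s)}$ is the social welfare of this allocation with respect to the valuations $v,\rho$. **Corollary 4.6.** Let all $v_i$ be positive integer multiples of $\varepsilon>0$, and fix any rule that selects the maximal vectors in the clinching steps. (a) For all $\rho^a,\rho^b\in\mathbb R_{>0}^M$ whose entries are integer multiples of $\varepsilon$, $$\mathrm{SW}^{\mathbb M(\rho^a,\rho^b)}+\mathrm{SW}^{\mathbb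 M(\rho^b,\rho^a)}\ \ge\ \tfrac12\bigl(\mathrm{LW}^{\mathrm{OPT}(\rho^a)}+\mathrm{LW}^{\mathrm{OPT}(\rho^b)}\bigr).$$ (b) Hence, if $G_j$ ($j\in M$) are probability distributions supported on positive integer multiples of $\varepsilon$ and all $\rho_j,\rho^s_j\sim G_j$ are independent, then $\mathrm{SW}^{\mathbb M(\rho,\rho^s)}$ and $\mathrm{LW}^{\mathrm{OPT}(\rho)}$ are random variables (measurable up to null sets) and, as expectations in $[0,\infty]$, $$\mathbb E_{\rho,\rho^s}\bigl[\mathrm{SW}^{\mathbb M(\rho,\rho^s)}\bigr]\ \ge\ \tfrac12\,\mathbb E_{\rho}\bigl[\mathrm{LW}^{\mathrm{OPT}(\rho)}\bigr].$$ -/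

import Mathlib

open scoped NNReal ENNReal

noncomputable section

namespace TwoSided

/-- A two-sided market with buyers `N` and sellers `M`. The edge set is given by the sets
`nbr j` of buyers adjacent to seller `j`, so that the set of edges at `j` is identified with
`nbr j`; `f j` is the monotone submodular function on subsets of `nbr j` that defines the
polymatroid of seller `j` (its values on other sets are irrelevant). -/
structure Market (N M : Type*) [DecidableEq N] where
  nbr : M → Finset N
  f : M → Finset N → ℝ≥0
  f_empty : ∀ j, f j ∅ = 0
  f_mono : ∀ j (F G : Finset N), F ⊆ G → G ⊆ nbr j → f j F ≤ f j G
  f_submod : ∀ j (F G : Finset N) (e : N), F ⊆ G → G ⊆ nbr j → e ∈ nbr j → e ∉ G →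
    (f j (insert e G) : ℝ) - f j G ≤ f j (insert e F) - f j F

namespace Market

variable {N M : Type*} [DecidableEq N]

/-- The total goods of seller `j`. -/
def supply (A : Market N M) (j : M) : ℝ≥0 := A.f j (A.nbr j)

/-- The polymatroid of feasible transaction vectors. Vectors indexed by the edges are functions
on all pairs that vanish off the edges. -/
def poly (A : Market N M) : Set (N → M → ℝ≥0) :=
  {w | (∀ i j, i ∉ A.nbr j → w i j = 0) ∧ ∀ j, ∀ F ⊆ A.nbr j, ∑ i ∈ F, w i j ≤ A.f j F}

/-- The market with only the sellers in `S`. -/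
def restrict (A : Market N M) (S : Finset M) : Market N S where
  nbr j := A.nbr j
  f j := A.f j
  f_empty j := A.f_empty j
  f_mono j := A.f_mono j
  f_submod j := A.f_submod j

/-- Preprocessing: every seller `j` gets a virtual buyer `Sum.inr j`, adjacent only to `j`, and a
set of edges at `j` that contains the virtual edge gets the value of the full edge set. -/
def withVirtual [DecidableEq M] (A : Market N M) : Market (N ⊕ M) M where
  nbr j := (A.nbr j).disjSum {j}
  f j F := if Sum.inr j ∈ F then A.f j (A.nbr j) else A.f j F.toLeft
  f_empty j := by
    have h : (∅ : Finset (N ⊕ M)).toLeft = ∅ := by ext; simp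
    simpa [h] using A.f_empty j
  f_mono j F G hFG hG := by
    have hl : G.toLeft ⊆ A.nbr j := by
      intro i hi
      have := hG (Finset.mem_toLeft.1 hi)
      simpa using this
    have hFl : F.toLeft ⊆ G.toLeft := by
      intro i hi
      exact Finset.mem_toLeft.2 (hFG (Finset.mem_toLeft.1 hi))
    by_cases h1 : Sum.inr j ∈ F
    · simp [h1, hFG h1]
    · by_cases h2 : Sum.inr j ∈ G
      · simpa [h1, h2] using A.f_mono j _ _ (hFl.trans hl) subset_rfl
      · simpa [h1, h2] using A.f_mono j _ _ hFl hl
  f_submod j F G e hFG hG he heG := by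
    have hl : G.toLeft ⊆ A.nbr j := by
      intro i hi
      have := hG (Finset.mem_toLeft.1 hi)
      simpa using this
    have hFl : F.toLeft ⊆ G.toLeft := by
      intro i hi
      exact Finset.mem_toLeft.2 (hFG (Finset.mem_toLeft.1 hi))
    rcases e with i | k
    · have hi : i ∈ A.nbr j := by simpa using he
      have hiG : i ∉ G.toLeft := fun h => heG (Finset.mem_toLeft.1 h)
      have key := A.f_submod j _ _ i hFl hl hi hiG
      have hmF : A.f j F.toLeft ≤ A.f j (insert i F.toLeft) :=
        A.f_mono j _ _ (Finset.subset_insert _ _)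
          (Finset.insert_subset hi (hFl.trans hl))
      have hmF' : (A.f j F.toLeft : ℝ) ≤ A.f j (insert i F.toLeft) := by exact_mod_cast hmF
      by_cases h2 : Sum.inr j ∈ G
      · by_cases h1 : Sum.inr j ∈ F
        · simp [h1, h2]
        · simpa [h1, h2] using hmF
      · have h1 : Sum.inr j ∉ F := fun h => h2 (hFG h)
        simpa [h1, h2] using key
    · have hk : k = j := by simpa using he
      subst hk
      have h1 : Sum.inr k ∉ F := fun h => heG (hFG h)
      have hm : A.f k F.toLeft ≤ A.f k G.toLeft := A.f_mono k _ _ hFl hl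
      have hm' : (A.f k F.toLeft : ℝ) ≤ A.f k G.toLeft := by exact_mod_cast hm
      simp only [Finset.mem_insert_self, if_true, h1, heG, if_false]
      linarith

/-- The remnant supply polytope `P_{w,d}`. -/
def remnant [Fintype M] (A : Market N M) (w : N → M → ℝ≥0) (d : N → ℝ≥0∞) :
    Set (N → M → ℝ≥0) :=
  {y | (∀ i j, i ∉ A.nbr j → y i j = 0) ∧ w + y ∈ A.poly ∧
    ∀ i, ((∑ j, y i j : ℝ≥0) : ℝ≥0∞) ≤ d i}

/-- `P^i_{w,d}(ξ)`: the possible future total transactions of the buyers other than `i` if buyer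
`i` transacts `ξ`. -/
def others [Fintype M] (A : Market N M) (w : N → M → ℝ≥0) (d : N → ℝ≥0∞) (i : N)
    (ξ : M → ℝ≥0) : Set ({k : N // k ≠ i} → ℝ≥0) :=
  {u | ∃ y ∈ A.remnant w d, y i = ξ ∧ ∀ k, ∑ j, y k.1 j = u k}

/-- The clinching polytope `P^i_{w,d}` of buyer `i`. -/
def clinchPoly [Fintype M] (A : Market N M) (w : N → M → ℝ≥0) (d : N → ℝ≥0∞) (i : N) :
    Set (M → ℝ≥0) :=
  {ξ | (∀ j, i ∉ A.nbr j → ξ j = 0) ∧ A.others w d i ξ = A.others w d i 0}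

end Market

/-- An allocation: transactions, payments of buyers, and revenues of sellers. -/
structure Allocation (N M : Type*) where
  w : N → M → ℝ≥0
  p : N → ℝ≥0
  r : M → ℝ≥0

section Welfare

variable {N M : Type*} [Fintype N] [Fintype M] [DecidableEq N]

/-- Social welfare for valuations `v` of buyers and `ρ` of sellers: every participant counts the
value of the goods that she holds after the auction. -/
def SW (A : Market N M) (v : N → ℝ≥0) (ρ : M → ℝ≥0) (a : Allocation N M) : ℝ :=
  ∑ i, (v i : ℝ) * ∑ j, (a.w i j : ℝ) +
    ∑ j, (ρ j : ℝ) * ((A.supply j : ℝ) - ∑ i, (a.w i j : ℝ))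

/-- Liquid welfare: the value of each buyer is capped by her budget. -/
def LW (A : Market N M) (v : N → ℝ≥0) (ρ : M → ℝ≥0) (B : N → ℝ≥0∞) (a : Allocation N M) : ℝ :=
  ∑ i, (min ((v i * ∑ j, a.w i j : ℝ≥0) : ℝ≥0∞) (B i)).toReal +
    ∑ j, (ρ j : ℝ) * ((A.supply j : ℝ) - ∑ i, (a.w i j : ℝ))

/-- Allocations that satisfy the budget and the polymatroid constraints. -/
def feasible (A : Market N M) (B : N → ℝ≥0∞) : Set (Allocation N M) :=
  {a | (∀ i, (a.p i : ℝ≥0∞) ≤ B i) ∧ a.w ∈ A.poly}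

/-- The optimal liquid welfare. -/
def LWOPT (A : Market N M) (v : N → ℝ≥0) (ρ : M → ℝ≥0) (B : N → ℝ≥0∞) : ℝ :=
  sSup (LW A v ρ B '' feasible A B)

end Welfare

/-- State of the clinching auction: price clocks, demands, payments, revenues, transactions, and
the position (counted from `0`) of the buyer whose clock is the next to increase. -/
structure State (N M : Type*) where
  c : N → ℝ≥0
  d : N → ℝ≥0∞
  p : N → ℝ≥0
  r : M → ℝ≥0
  w : N → M → ℝ≥0
  l : ℕ

/-- A selection method for the clinching step: it chooses a maximal vector of the clinching
polytope whenever there is one. -/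
structure ClinchRule {N M : Type*} [Fintype M] [DecidableEq N] (A : Market N M) where
  choose : State N M → N → (M → ℝ≥0)
  maximal : ∀ (s : State N M) (i : N), (∃ ξ, Maximal (· ∈ A.clinchPoly s.w s.d i) ξ) →
    Maximal (· ∈ A.clinchPoly s.w s.d i) (choose s i)

/-- The demand of a buyer with price clock `c`, bid `v`, budget `B` and payment `p` so far. At
price zero the demand is infinite. -/
def demand (c v : ℝ≥0) (B : ℝ≥0∞) (p : ℝ≥0) : ℝ≥0∞ :=
  if c < v then (if c = 0 then ⊤ else (B - p) / c) else 0

section OneSided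

variable {N M : Type*} [Fintype M] [DecidableEq N]

/-- Buyer `i` clinches. The revenues are accumulated buyer by buyer; the price clocks do not
change during the clinching step. -/
def clinchBuyer (A : Market N M) (rule : ClinchRule A) (v : N → ℝ≥0) (B : N → ℝ≥0∞)
    (s : State N M) (i : N) : State N M :=
  let ξ := rule.choose s i
  let p' := s.p i + s.c i * ∑ j, ξ j
  { c := s.c
    d := Function.update s.d i (demand (s.c i) (v i) (B i) p')
    p := Function.update s.p i p'
    r := fun j => s.r j + s.c i * ξ j
    w := Function.update s.w i (s.w i + ξ)
    l := s.l }

/-- The clinching step: the buyers clinch one after the other in the order of the list. -/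
def clinching (A : Market N M) (rule : ClinchRule A) (v : N → ℝ≥0) (B : N → ℝ≥0∞)
    (order : List N) (s : State N M) : State N M :=
  order.foldl (clinchBuyer A rule v B) s

/-- The price clock of the buyer at position `s.l` increases by `ε`, her demand is updated, and
the position advances cyclically. -/
def raisePrice (v : N → ℝ≥0) (B : N → ℝ≥0∞) (ε : ℝ≥0) (order : List N) (s : State N M) :
    State N M :=
  match order[s.l]? with
  | none => s
  | some i =>
    { c := Function.update s.c i (s.c i + ε)
      d := Function.update s.d i (demand (s.c i + ε) (v i) (B i) (s.p i))
      p := s.p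
      r := s.r
      w := s.w
      l := (s.l + 1) % order.length }

/-- One iteration of the loop. -/
def iteration (A : Market N M) (rule : ClinchRule A) (v : N → ℝ≥0) (B : N → ℝ≥0∞) (ε : ℝ≥0)
    (order : List N) (s : State N M) : State N M :=
  raisePrice v B ε order (clinching A rule v B order s)

/-- The initial state. -/
def initState (N M : Type*) : State N M where
  c _ := 0
  d _ := ⊤
  p _ := 0
  r _ := 0
  w _ _ := 0
  l := 0

/-- The state in which the loop stops: the first one in which all demands are zero. -/
def finalState (A : Market N M) (rule : ClinchRule A) (v : N → ℝ≥0) (B : N → ℝ≥0∞) (ε : ℝ≥0)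
    (order : List N) : State N M :=
  (iteration A rule v B ε order)^[sInf {t : ℕ | ∀ i,
    ((iteration A rule v B ε order)^[t] (initState N M)).d i = 0}] (initState N M)

end OneSided

section Mechanisms

variable {N M : Type*} [Fintype N] [Fintype M] [LinearOrder N] [LinearOrder M]

/-- All buyers of the modified market: first the original ones, then the virtual ones in the order
of their sellers. -/
def buyerOrder (N M : Type*) [Fintype N] [Fintype M] [LinearOrder N] [LinearOrder M] :
    List (N ⊕ M) :=
  ((Finset.univ : Finset N).sort (· ≤ ·)).map Sum.inl ++
    ((Finset.univ : Finset M).sort (· ≤ ·)).map Sum.inr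

/-- The final state of the Polyhedral Clinching Auction in the modified market. The virtual buyer
of seller `j` bids `ρ j` and has an infinite budget. -/
def pcaState (A : Market N M) (v : N → ℝ≥0) (ρ : M → ℝ≥0) (B : N → ℝ≥0∞) (ε : ℝ≥0)
    (rule : ClinchRule A.withVirtual) : State (N ⊕ M) M :=
  finalState A.withVirtual rule (Sum.elim v ρ) (Sum.elim B fun _ => ⊤) ε (buyerOrder N M)

/-- The Polyhedral Clinching Auction with price increment `ε`. All transactions of the virtual
buyers are cancelled; the revenue of a seller includes the payment of her virtual buyer, so that
the subtraction is not truncated. -/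
def pca (A : Market N M) (v : N → ℝ≥0) (ρ : M → ℝ≥0) (B : N → ℝ≥0∞) (ε : ℝ≥0)
    (rule : ClinchRule A.withVirtual) : Allocation N M :=
  let s := pcaState A v ρ B ε rule
  { w := fun i j => s.w (Sum.inl i) j
    p := fun i => s.p (Sum.inl i)
    r := fun j => s.r j - s.p (Sum.inr j) }

/-- The single-sample mechanism for bids `v` of buyers, bids `ρ` and samples `σ` of sellers: the
Polyhedral Clinching Auction is run with the sellers whose sample is at least their bid, with the
samples in place of the bids; a participating seller gets her sample value per unit sold. -/
def mech (A : Market N M) (v : N → ℝ≥0) (ρ σ : M → ℝ≥0) (B : N → ℝ≥0∞) (ε : ℝ≥0)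
    (rule : ∀ S : Finset M, ClinchRule (A.restrict S).withVirtual) : Allocation N M :=
  let S : Finset M := Finset.univ.filter fun j => ρ j ≤ σ j
  let a := pca (A.restrict S) v (fun j => σ j) B ε (rule S)
  { w := fun i j => if h : j ∈ S then a.w i ⟨j, h⟩ else 0
    p := a.p
    r := fun j => if h : j ∈ S then σ j * ∑ i, a.w i ⟨j, h⟩ else 0 }

end Mechanisms

/-- Positive multiples of `ε`. -/
def posMultiples (ε : ℝ≥0) : Set ℝ≥0 := {x | 0 < x ∧ ∃ k : ℕ, x = k * ε}

end TwoSided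

end

/-! Take transactions with liquid welfare `L` and let the virtual buyers absorb what they leave
unsold. The auction on the enlarged market ends with social welfare at least `L`, because of the
invariant `Potential`: with `lam` the price of the current round, there are further transactions
`y`, affordable even at full value, such that `L` is at most the value sold, plus `lam` per unsold
unit, plus `max 0 (v k - lam)` per unit of `y`. It holds at the start for the given transactions cut
down to the budgets (`potential_initState`). Clinching moves units from `y` to `w` at a price at
most their value, which loses nothing (`Potential.clinchBuyer`); a rise of `lam` gains on all unsold
units what it loses at most on those of `y` (`Potential.add_price`). Once everything is sold, only
the value sold remains.

That everything is sold is a second invariant: the demands can absorb all remaining goods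
(`fullRemnant`). After a maximal clinch of one buyer the others can absorb them without her
(`exists_full_row_eq`), so the fall of her demand does no harm. These arguments rearrange future
transactions by polymatroid augmentation (`Market.exists_augment`).

For the samples, split the sellers according to which of the two profiles is larger. Capped values
are subadditive, so the liquid welfare for the larger profile is at most the sum over the two runs.
A run values the goods kept by a seller at her sample instead of her value; the excess is at most
sample times supply, which is what she contributes in the other run, where she is excluded and keeps
everything. On ties there is no excess. So the two social welfares together dominate the optimum for
each profile, and averaging gives (a). Swapping the two profiles preserves their joint law, which
gives (b). -/

noncomputable section

set_option linter.unusedSectionVars false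

namespace TwoSided

/-! ### Polymatroids: images under aggregation, and augmentation -/

section Polymatroid

variable {α β : Type*} [DecidableEq α] [DecidableEq β]

/-- Monotone submodular set functions that vanish at the empty set. -/
structure IsPolymatroid (f : Finset α → ℝ) : Prop where
  empty : f ∅ = 0
  mono : ∀ F G, F ⊆ G → f F ≤ f G
  submod : ∀ F G, f (F ∪ G) + f (F ∩ G) ≤ f F + f G

/-- Fixing the value `b` of the element `e` in a polymatroid leaves a polymatroid. -/
theorem IsPolymatroid.fix {f : Finset α → ℝ} (hf : IsPolymatroid f) (e : α) {b : ℝ}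
    (hb : b ≤ f {e}) :
    -- A set of other elements is bounded either alone or together with `e`, of which `b` is already
    -- used.
    IsPolymatroid fun F => min (f (F.erase e)) (f (insert e F) - b) where
  empty := by simpa [hf.empty] using hb
  mono F G h := min_le_min (hf.mono _ _ (Finset.erase_subset_erase _ h))
    (sub_le_sub_right (hf.mono _ _ (Finset.insert_subset_insert _ h)) _)
  submod F G := by
    have h1 := hf.submod (F.erase e) (G.erase e)
    have h2 := hf.submod (insert e F) (insert e G)
    have h3 := hf.submod (F.erase e) (insert e G)
    have h4 := hf.submod (insert e F) (G.erase e)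
    have e1 : F.erase e ∪ G.erase e = (F ∪ G).erase e := by ext x; simp; tauto
    have e2 : F.erase e ∩ G.erase e = (F ∩ G).erase e := by ext x; simp; tauto
    have e3 : insert e F ∪ insert e G = insert e (F ∪ G) := by ext x; simp
    have e4 : insert e F ∩ insert e G = insert e (F ∩ G) := by ext x; simp; tauto
    have e5 : F.erase e ∪ insert e G = insert e (F ∪ G) := by ext x; simp; tauto
    have e6 : F.erase e ∩ insert e G = (F ∩ G).erase e := by
      ext x; simp only [Finset.mem_inter, Finset.mem_erase, Finset.mem_insert]; tauto
    have e7 : insert e F ∪ G.erase e = insert e (F ∪ G) := by ext x; simp; tauto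
    have e8 : insert e F ∩ G.erase e = (F ∩ G).erase e := by
      ext x; simp only [Finset.mem_inter, Finset.mem_erase, Finset.mem_insert]; tauto
    rw [e1, e2] at h1
    rw [e3, e4] at h2
    rw [e5, e6] at h3
    rw [e7, e8] at h4
    have a1 := min_le_left (f ((F ∪ G).erase e)) (f (insert e (F ∪ G)) - b)
    have a2 := min_le_right (f ((F ∪ G).erase e)) (f (insert e (F ∪ G)) - b)
    have a3 := min_le_left (f ((F ∩ G).erase e)) (f (insert e (F ∩ G)) - b)
    have a4 := min_le_right (f ((F ∩ G).erase e)) (f (insert e (F ∩ G)) - b)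
    rcases min_choice (f (F.erase e)) (f (insert e F) - b) with h | h <;>
    rcases min_choice (f (G.erase e)) (f (insert e G) - b) with h' | h' <;>
    rw [h, h'] <;> linarith

/-- A vector dominated by the image of a polymatroid under a map is the image of a vector of the
polymatroid. -/
theorem IsPolymatroid.exists_lift [Fintype α] (π : β → α) (E : Finset β) :
    ∀ {f : Finset β → ℝ}, IsPolymatroid f → ∀ {x : α → ℝ}, 0 ≤ x →
    (∀ A : Finset α, ∑ a ∈ A, x a ≤ f (E.filter (π · ∈ A))) →
    ∃ y : β → ℝ, 0 ≤ y ∧ (∀ F ⊆ E, ∑ e ∈ F, y e ≤ f F) ∧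
      ∀ a, ∑ e ∈ E with π e = a, y e = x a := by
  induction E using Finset.induction_on with
  | empty =>
    intro f hf x hx h
    refine ⟨0, le_rfl, fun F hF => ?_, fun a => ?_⟩
    · simp [Finset.subset_empty.1 hF, hf.empty]
    · have := h {a}
      simp only [Finset.sum_singleton, Finset.filter_empty, hf.empty] at this
      simpa using (le_antisymm this (hx a)).symm
  | insert e E he ih =>
    intro f hf x hx h
    obtain ⟨a, ha⟩ : ∃ a, π e = a := ⟨_, rfl⟩
    have pre_in : ∀ A : Finset α, a ∈ A →
        (insert e E).filter (π · ∈ A) = insert e (E.filter (π · ∈ A)) := by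
      intro A hA; rw [Finset.filter_insert, if_pos (by rwa [ha])]
    have pre_out : ∀ A : Finset α, a ∉ A →
        (insert e E).filter (π · ∈ A) = E.filter (π · ∈ A) := by
      intro A hA; rw [Finset.filter_insert, if_neg (by rwa [ha])]
    have hEe : ∀ A : Finset α, e ∉ E.filter (π · ∈ A) := fun A h => he (Finset.mem_filter.1 h).1
    -- `g A` is the least nonnegative value at `e` forced by `A`: what the remaining elements over
    -- `A` cannot carry. The value chosen at `e` is the largest of these; submodularity keeps it
    -- below every upper bound (`hb2`).
    let g : Finset α → ℝ := fun A =>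
      max 0 (if a ∈ A then ∑ i ∈ A, x i - f (E.filter (π · ∈ A)) else 0)
    let b : ℝ := Finset.univ.sup' Finset.univ_nonempty g
    have hgb : ∀ A, g A ≤ b := fun A => Finset.le_sup' g (Finset.mem_univ A)
    have hb0 : 0 ≤ b := (le_max_left _ _).trans (hgb ∅)
    have hb1 : ∀ A, a ∈ A → ∑ i ∈ A, x i - f (E.filter (π · ∈ A)) ≤ b := by
      intro A hA
      refine le_trans ?_ (hgb A)
      simp only [g, if_pos hA]
      exact le_max_right _ _
    have hb2 : ∀ A, a ∉ A → b ≤ f (insert e (E.filter (π · ∈ A))) - ∑ i ∈ A, x i := by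
      intro A hA
      refine Finset.sup'_le _ _ fun A' _ => max_le ?_ ?_
      · have h1 := h A
        rw [pre_out A hA] at h1
        have h2 := hf.mono _ _ (Finset.subset_insert e (E.filter (π · ∈ A)))
        linarith
      · split_ifs with hA'
        · have h1 := h (A' ∪ A)
          have h2 := h (A' ∩ A)
          rw [pre_in _ (by simp [hA'])] at h1
          rw [pre_out _ (by simp [hA])] at h2
          have h3 := hf.submod (E.filter (π · ∈ A')) (insert e (E.filter (π · ∈ A)))
          have e1 : E.filter (π · ∈ A') ∪ insert e (E.filter (π · ∈ A)) =
              insert e (E.filter (π · ∈ A' ∪ A)) := by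
            ext k; simp only [Finset.mem_union, Finset.mem_insert, Finset.mem_filter]; tauto
          have e2 : E.filter (π · ∈ A') ∩ insert e (E.filter (π · ∈ A)) =
              E.filter (π · ∈ A' ∩ A) := by
            ext k
            simp only [Finset.mem_inter, Finset.mem_insert, Finset.mem_filter]
            constructor
            · rintro ⟨⟨h5, h6⟩, rfl | h7⟩
              · exact absurd h5 he
              · tauto
            · tauto
          rw [e1, e2] at h3
          have h4 := Finset.sum_union_inter (s₁ := A') (s₂ := A) (f := x)
          linarith
        · have h1 := h A
          rw [pre_out A hA] at h1
          have h2 := hf.mono _ _ (Finset.subset_insert e (E.filter (π · ∈ A)))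
          linarith
    have hb3 : b ≤ x a := by
      refine Finset.sup'_le _ _ fun A _ => max_le (hx a) ?_
      split_ifs with hA
      · have h1 := h (A.erase a)
        rw [pre_out _ (by simp)] at h1
        have h2 := hf.mono (E.filter (π · ∈ A.erase a)) (E.filter (π · ∈ A)) (by
          intro k; simp only [Finset.mem_filter, Finset.mem_erase]; tauto)
        have h3 := Finset.add_sum_erase A x hA
        linarith
      · exact hx a
    have hb4 : b ≤ f {e} := by simpa using hb2 ∅ (by simp)
    obtain ⟨y, hy0, hyF, hyx⟩ := ih (hf.fix e hb4) (x := Function.update x a (x a - b))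
      (by
        intro k
        by_cases hk : k = a
        · subst hk; simpa using hb3
        · simpa [hk] using hx k)
      (by
        intro A
        have e1 : (E.filter (π · ∈ A)).erase e = E.filter (π · ∈ A) :=
          Finset.erase_eq_of_notMem (hEe A)
        rw [e1]
        by_cases hA : a ∈ A
        · rw [Finset.sum_update_of_mem hA]
          have h1 := hb1 A hA
          have h2 := h A
          rw [pre_in A hA] at h2
          have h3 := Finset.sum_sdiff_eq_sub (f := x) (Finset.singleton_subset_iff.2 hA)
          rw [Finset.sum_singleton] at h3
          rw [h3]
          exact le_min (by linarith) (by linarith)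
        · rw [Finset.sum_update_of_notMem hA]
          have h1 := hb2 A hA
          have h2 := h A
          rw [pre_out A hA] at h2
          exact le_min (by linarith) (by linarith))
    refine ⟨Function.update y e b, fun k => ?_, fun F hF => ?_, fun k => ?_⟩
    · by_cases hk : k = e
      · subst hk; simpa using hb0
      · simpa [hk] using hy0 k
    · by_cases hF' : e ∈ F
      · rw [Finset.sum_update_of_mem hF', ← Finset.erase_eq]
        have h1 := hyF (F.erase e) (by
          intro k hk
          have := hF (Finset.mem_of_mem_erase hk)
          exact (Finset.mem_insert.1 this).resolve_left (Finset.ne_of_mem_erase hk))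
        have h2 := h1.trans (min_le_right _ _)
        rw [Finset.insert_erase hF'] at h2
        linarith
      · rw [Finset.sum_update_of_notMem hF']
        have h1 := hyF F (fun k hk => (Finset.mem_insert.1 (hF hk)).resolve_left
          (by rintro rfl; exact hF' hk))
        have h2 := h1.trans (min_le_left _ _)
        rwa [Finset.erase_eq_of_notMem hF'] at h2
    · have h1 := hyx k
      have hn : e ∉ E.filter (π · = k) := fun h => he (Finset.mem_filter.1 h).1
      rw [Finset.filter_insert]
      by_cases hk : k = a
      · subst hk
        rw [if_pos ha, Finset.sum_update_of_mem (Finset.mem_insert_self _ _), ← Finset.erase_eq,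
          Finset.erase_insert hn, h1]
        simp
      · rw [if_neg (by rw [ha]; exact fun h => hk h.symm), Finset.sum_update_of_notMem hn, h1]
        simp [hk]

/-- Augmentation: a vector of a polymatroid can be raised, towards another vector of the
polymatroid, to at least its total. -/
theorem IsPolymatroid.exists_augment [Fintype α] {f : Finset α → ℝ} (hf : IsPolymatroid f)
    {x z : α → ℝ} (hx : ∀ A, ∑ a ∈ A, x a ≤ f A) (hz : ∀ A, ∑ a ∈ A, z a ≤ f A) :
    ∃ x' : α → ℝ, x ≤ x' ∧ (∀ a, x' a ≤ max (x a) (z a)) ∧ (∀ A, ∑ a ∈ A, x' a ≤ f A) ∧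
      ∑ a, z a ≤ ∑ a, x' a := by
  have key : ∀ s : Finset α, ∃ x' : α → ℝ, x ≤ x' ∧ (∀ a, x' a ≤ max (x a) (z a)) ∧
      (∀ A, ∑ a ∈ A, x' a ≤ f A) ∧
      ∀ a ∈ s, z a ≤ x' a ∨ ∃ A, a ∈ A ∧ ∑ i ∈ A, x' i = f A := by
    intro s
    induction s using Finset.induction_on with
    | empty => exact ⟨x, le_rfl, fun a => le_max_left _ _, hx, by simp⟩
    | insert e s _ ih =>
      obtain ⟨x', h1, h2, h3, h4⟩ := ih
      by_cases hze : z e ≤ x' e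
      · refine ⟨x', h1, h2, h3, fun a ha => ?_⟩
        rcases Finset.mem_insert.1 ha with rfl | ha
        exacts [Or.inl hze, h4 a ha]
      push Not at hze
      have hne : (Finset.univ.filter fun A : Finset α => e ∈ A).Nonempty := ⟨{e}, by simp⟩
      -- Among the sets containing `e`, `A₀` is the first to become tight when coordinate `e` is
      -- raised; the raise stops there or at `z e`.
      obtain ⟨A₀, hA₀, hmin⟩ := Finset.exists_min_image _
        (fun A => f A - ∑ i ∈ A, x' i) hne
      simp only [Finset.mem_filter, Finset.mem_univ, true_and] at hA₀ hmin
      obtain ⟨t, ht⟩ : ∃ t, t = min (z e - x' e) (f A₀ - ∑ i ∈ A₀, x' i) := ⟨_, rfl⟩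
      have ht0 : 0 ≤ t := by rw [ht]; exact le_min (by linarith) (by linarith [h3 A₀])
      have htz : t ≤ z e - x' e := ht ▸ min_le_left _ _
      have htA : t ≤ f A₀ - ∑ i ∈ A₀, x' i := ht ▸ min_le_right _ _
      have hsum : ∀ A, ∑ i ∈ A, (x' i + if i = e then t else 0) =
          ∑ i ∈ A, x' i + if e ∈ A then t else 0 := by
        intro A; rw [Finset.sum_add_distrib, Finset.sum_ite_eq']
      have h3' : ∀ A, ∑ i ∈ A, (x' i + if i = e then t else 0) ≤ f A := by
        intro A
        rw [hsum]
        split_ifs with hA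
        · linarith [hmin A hA]
        · linarith [h3 A]
      refine ⟨fun i => x' i + if i = e then t else 0, fun i => ?_, fun i => ?_, h3',
        fun a ha => ?_⟩
      · have := h1 i
        dsimp only
        split_ifs <;> linarith
      · have := h2 i
        dsimp only
        split_ifs with hi
        · subst hi; exact le_max_of_le_right (by linarith)
        · simpa using this
      · rcases Finset.mem_insert.1 ha with rfl | ha
        · rcases min_choice (z a - x' a) (f A₀ - ∑ i ∈ A₀, x' i) with h | h
          · left; simp only [if_true]; linarith
          · right
            refine ⟨A₀, hA₀, ?_⟩
            rw [hsum, if_pos hA₀]; linarith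
        · rcases h4 a ha with h | ⟨A, hA, h⟩
          · left; dsimp only; split_ifs <;> linarith
          · right
            refine ⟨A, hA, le_antisymm (h3' A) ?_⟩
            rw [hsum]
            split_ifs <;> linarith
  obtain ⟨x', h1, h2, h3, h4⟩ := key Finset.univ
  refine ⟨x', h1, h2, h3, ?_⟩
  -- Tight sets are closed under union by submodularity, so a single tight `T` covers all
  -- coordinates still below `z`. There `z` totals at most `f T`, and off `T` it is dominated
  -- pointwise.
  have tight : ∀ s : Finset α, (∀ a ∈ s, ∃ A, a ∈ A ∧ ∑ i ∈ A, x' i = f A) →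
      ∃ T, s ⊆ T ∧ ∑ i ∈ T, x' i = f T := by
    intro s
    induction s using Finset.induction_on with
    | empty => exact fun _ => ⟨∅, by simp, by simp [hf.empty]⟩
    | insert e s _ ih =>
      intro h
      obtain ⟨T, hsT, hT⟩ := ih fun a ha => h a (Finset.mem_insert_of_mem ha)
      obtain ⟨A, heA, hA⟩ := h e (Finset.mem_insert_self _ _)
      refine ⟨A ∪ T, Finset.insert_subset (by simp [heA])
        (hsT.trans Finset.subset_union_right), ?_⟩
      have := hf.submod A T
      have := h3 (A ∪ T)
      have := h3 (A ∩ T)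
      have := Finset.sum_union_inter (s₁ := A) (s₂ := T) (f := x')
      linarith
  obtain ⟨T, hsT, hT⟩ := tight (Finset.univ.filter fun a => x' a < z a) (by
    intro a ha
    exact (h4 a (Finset.mem_univ _)).resolve_left (not_le.2 (Finset.mem_filter.1 ha).2))
  rw [← Finset.sum_add_sum_compl T z, ← Finset.sum_add_sum_compl T x']
  refine add_le_add (hT ▸ hz T) (Finset.sum_le_sum fun a ha => ?_)
  by_contra hlt
  exact Finset.mem_compl.1 ha (hsT (by simpa using hlt))

/-- The largest monotone set function below `φ`. -/
def monoClosure [Fintype β] (φ : Finset β → ℝ) (F : Finset β) : ℝ :=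
  (Finset.univ.filter (F ⊆ ·)).inf' ⟨F, by simp⟩ φ

theorem monoClosure_le [Fintype β] (φ : Finset β → ℝ) {F H : Finset β} (h : F ⊆ H) :
    monoClosure φ F ≤ φ H :=
  Finset.inf'_le _ (by simpa using h)

theorem le_monoClosure [Fintype β] {φ : Finset β → ℝ} {F : Finset β} {a : ℝ}
    (h : ∀ H, F ⊆ H → a ≤ φ H) : a ≤ monoClosure φ F :=
  Finset.le_inf' _ _ fun H hH => h H (by simpa using hH)

theorem exists_monoClosure_eq [Fintype β] (φ : Finset β → ℝ) (F : Finset β) :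
    ∃ H, F ⊆ H ∧ monoClosure φ F = φ H := by
  obtain ⟨H, hH, h⟩ := Finset.exists_mem_eq_inf' (s := Finset.univ.filter (F ⊆ ·))
    ⟨F, by simp⟩ φ
  exact ⟨H, by simpa using hH, h⟩

/-- The slack left by earlier transactions is submodular but need not be monotone. Its monotone
closure admits the same nonnegative vectors, and stays submodular since unions and intersections of
minimizing supersets are again supersets. -/
theorem isPolymatroid_monoClosure [Fintype β] {φ : Finset β → ℝ} (h0 : φ ∅ = 0)
    (hnn : ∀ F, 0 ≤ φ F) (hsub : ∀ F G, φ (F ∪ G) + φ (F ∩ G) ≤ φ F + φ G) :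
    IsPolymatroid (monoClosure φ) where
  empty := le_antisymm (h0 ▸ monoClosure_le φ subset_rfl) (le_monoClosure fun H _ => hnn H)
  mono F G h := le_monoClosure fun H hH => monoClosure_le φ (h.trans hH)
  submod F G := by
    obtain ⟨H, hH, e1⟩ := exists_monoClosure_eq φ F
    obtain ⟨K, hK, e2⟩ := exists_monoClosure_eq φ G
    have h1 := monoClosure_le φ (Finset.union_subset_union hH hK)
    have h2 := monoClosure_le φ (Finset.inter_subset_inter hH hK)
    have := hsub H K
    rw [e1, e2]
    linarith

theorem IsPolymatroid.comap {f : Finset β → ℝ} (hf : IsPolymatroid f) (π : β → α)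
    (E : Finset β) : IsPolymatroid fun A : Finset α => f (E.filter (π · ∈ A)) where
  empty := by simp [hf.empty]
  mono A A' h := hf.mono _ _ (by
    intro k hk
    simp only [Finset.mem_filter] at hk ⊢
    exact ⟨hk.1, h hk.2⟩)
  submod A A' := by
    have := hf.submod (E.filter (π · ∈ A)) (E.filter (π · ∈ A'))
    rw [← Finset.filter_or, ← Finset.filter_and] at this
    simpa only [Finset.mem_union, Finset.mem_inter] using this

/-- Augmentation in the image of a polymatroid under a map. -/
theorem exists_augment_map [Fintype α] [Fintype β] {φ : Finset β → ℝ} (h0 : φ ∅ = 0)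
    (hnn : ∀ F, 0 ≤ φ F) (hsub : ∀ F G, φ (F ∪ G) + φ (F ∩ G) ≤ φ F + φ G) (π : β → α)
    {y z : β → ℝ} (hy0 : 0 ≤ y) (hz0 : 0 ≤ z) (hy : ∀ F, ∑ e ∈ F, y e ≤ φ F)
    (hz : ∀ F, ∑ e ∈ F, z e ≤ φ F) :
    ∃ y' : β → ℝ, 0 ≤ y' ∧ (∀ F, ∑ e ∈ F, y' e ≤ φ F) ∧
      (∀ a, ∑ e with π e = a, y e ≤ ∑ e with π e = a, y' e) ∧
      (∀ a, ∑ e with π e = a, y' e ≤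
        max (∑ e with π e = a, y e) (∑ e with π e = a, z e)) ∧
      ∑ e, z e ≤ ∑ e, y' e := by
  have hf := isPolymatroid_monoClosure h0 hnn hsub
  have push : ∀ (u : β → ℝ) (A : Finset α),
      ∑ a ∈ A, ∑ e with π e = a, u e = ∑ e with π e ∈ A, u e := by
    intro u A
    rw [← Finset.sum_fiberwise_of_maps_to (s := Finset.univ.filter (π · ∈ A)) (t := A) (g := π)
      (by simp)]
    refine Finset.sum_congr rfl fun a ha => Finset.sum_congr ?_ fun _ _ => rfl
    ext e
    simp only [Finset.mem_filter, Finset.mem_univ, true_and]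
    exact ⟨fun h => ⟨h ▸ ha, h⟩, fun h => h.2⟩
  have bound : ∀ u : β → ℝ, 0 ≤ u → (∀ F, ∑ e ∈ F, u e ≤ φ F) → ∀ A : Finset α,
      ∑ a ∈ A, ∑ e with π e = a, u e ≤ monoClosure φ (Finset.univ.filter (π · ∈ A)) := by
    intro u hu0 hu A
    rw [push]
    exact le_monoClosure fun H hH =>
      (Finset.sum_le_sum_of_subset_of_nonneg hH fun e _ _ => hu0 e).trans (hu H)
  -- Augment among the aggregated vectors, where every total is one coordinate, then lift the result
  -- back.
  obtain ⟨x', h1, h2, h3, h4⟩ := (hf.comap π Finset.univ).exists_augment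
    (bound y hy0 hy) (bound z hz0 hz)
  obtain ⟨y', g0, g1, g2⟩ := hf.exists_lift π Finset.univ (x := x')
    (fun a => (Finset.sum_nonneg fun e _ => hy0 e).trans (h1 a)) h3
  refine ⟨y', g0, fun F => (g1 F (Finset.subset_univ _)).trans (monoClosure_le φ subset_rfl),
    fun a => ?_, fun a => ?_, ?_⟩
  · rw [g2]; exact h1 a
  · rw [g2]; exact h2 a
  · have e1 := push z Finset.univ
    have e2 := push y' Finset.univ
    simp only [Finset.mem_univ, Finset.filter_true, g2] at e1 e2
    linarith

end Polymatroid

/-! ### Slack of a market and augmentation of transactions -/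

namespace Market

variable {N M : Type*} [DecidableEq N]

theorem f_submod_disjoint (A : Market N M) (j : M) {F G D : Finset N} (hFG : F ⊆ G)
    (hG : G ⊆ A.nbr j) (hD : D ⊆ A.nbr j) (hdis : Disjoint D G) :
    (A.f j (D ∪ G) : ℝ) - A.f j G ≤ A.f j (D ∪ F) - A.f j F := by
  induction D using Finset.induction_on with
  | empty => simp
  | insert e D he ih =>
    rw [Finset.insert_subset_iff] at hD
    rw [Finset.disjoint_insert_left] at hdis
    have h1 := ih hD.2 hdis.2
    have h2 := A.f_submod j (D ∪ F) (D ∪ G) e (Finset.union_subset_union_right hFG)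
      (Finset.union_subset hD.2 hG) hD.1 (by simp [he, hdis.1])
    rw [Finset.insert_union, Finset.insert_union]
    linarith

theorem f_union_add_inter (A : Market N M) (j : M) {F G : Finset N} (hF : F ⊆ A.nbr j)
    (hG : G ⊆ A.nbr j) :
    (A.f j (F ∪ G) : ℝ) + A.f j (F ∩ G) ≤ A.f j F + A.f j G := by
  have h := A.f_submod_disjoint j (F := F ∩ G) (G := G) (D := F \ G) Finset.inter_subset_right hG
    (Finset.sdiff_subset.trans hF) Finset.sdiff_disjoint
  rw [Finset.sdiff_union_self_eq_union, Finset.sdiff_union_inter] at h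
  linarith

theorem mem_poly_of_le {A : Market N M} {w w' : N → M → ℝ≥0} (h : w ≤ w') (hw' : w' ∈ A.poly) :
    w ∈ A.poly :=
  ⟨fun i j hij => le_antisymm (hw'.1 i j hij ▸ h i j) zero_le,
    fun j F hF => (Finset.sum_le_sum fun i _ => h i j).trans (hw'.2 j F hF)⟩

variable [Fintype N] [Fintype M]

/-- What is left of the bound on the transactions on a set `F` of edges after the transactions
`w`. -/
def slack [DecidableEq M] (A : Market N M) (w : N → M → ℝ≥0) (F : Finset (N × M)) : ℝ :=
  ∑ j, ((A.f j ((A.nbr j).filter fun k => (k, j) ∈ F) : ℝ) -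
    ∑ k ∈ (A.nbr j).filter fun k => (k, j) ∈ F, (w k j : ℝ))

section

variable [DecidableEq M] (A : Market N M) (w : N → M → ℝ≥0)

theorem slack_empty : A.slack w ∅ = 0 := by
  simp [slack, A.f_empty]

theorem slack_submod (F G : Finset (N × M)) :
    A.slack w (F ∪ G) + A.slack w (F ∩ G) ≤ A.slack w F + A.slack w G := by
  unfold slack
  rw [← Finset.sum_add_distrib, ← Finset.sum_add_distrib]
  refine Finset.sum_le_sum fun j _ => ?_
  have h := A.f_union_add_inter j (F := (A.nbr j).filter fun k => (k, j) ∈ F)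
    (G := (A.nbr j).filter fun k => (k, j) ∈ G) (Finset.filter_subset _ _)
    (Finset.filter_subset _ _)
  have h2 := Finset.sum_union_inter (s₁ := (A.nbr j).filter fun k => (k, j) ∈ F)
    (s₂ := (A.nbr j).filter fun k => (k, j) ∈ G) (f := fun k => (w k j : ℝ))
  rw [← Finset.filter_or, ← Finset.filter_and] at h h2
  simp only [Finset.mem_union, Finset.mem_inter]
  linarith

theorem sum_pairs (y : N → M → ℝ≥0) (hy : ∀ i j, i ∉ A.nbr j → y i j = 0)
    (F : Finset (N × M)) :
    ∑ e ∈ F, (y e.1 e.2 : ℝ) = ∑ j, ∑ k ∈ (A.nbr j).filter fun k => (k, j) ∈ F, (y k j : ℝ) := by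
  have h : ∀ j, ∑ k ∈ (A.nbr j).filter fun k => (k, j) ∈ F, (y k j : ℝ) =
      ∑ k, if (k, j) ∈ F then (y k j : ℝ) else 0 := by
    intro j
    rw [← Finset.sum_filter]
    refine Finset.sum_subset (fun k hk => by
      simp only [Finset.mem_filter, Finset.mem_univ, true_and] at hk ⊢; exact hk.2) ?_
    intro k hk hk'
    have : k ∉ A.nbr j := fun h => hk' (by
      simp only [Finset.mem_filter, Finset.mem_univ, true_and] at hk ⊢; exact ⟨h, hk⟩)
    simp [hy k j this]
  simp only [h]
  rw [Finset.sum_comm, ← Fintype.sum_prod_type' (f := fun k j =>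
    if (k, j) ∈ F then (y k j : ℝ) else 0)]
  simp

theorem sum_le_slack {y : N → M → ℝ≥0} (hy : ∀ i j, i ∉ A.nbr j → y i j = 0)
    (hwy : w + y ∈ A.poly) (F : Finset (N × M)) :
    ∑ e ∈ F, (y e.1 e.2 : ℝ) ≤ A.slack w F := by
  rw [sum_pairs A y hy]
  refine Finset.sum_le_sum fun j _ => ?_
  have h := hwy.2 j _ (Finset.filter_subset (fun k => (k, j) ∈ F) (A.nbr j))
  simp only [Pi.add_apply, Finset.sum_add_distrib] at h
  have h' : (∑ k ∈ (A.nbr j).filter fun k => (k, j) ∈ F, (w k j : ℝ)) +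
      ∑ k ∈ (A.nbr j).filter fun k => (k, j) ∈ F, (y k j : ℝ) ≤
      A.f j ((A.nbr j).filter fun k => (k, j) ∈ F) := by exact_mod_cast h
  linarith

/-- This makes the slack bounds alone force a vector to vanish off the edges. -/
theorem slack_singleton_eq {i : N} {j : M} (hij : i ∉ A.nbr j) :
    A.slack w {(i, j)} = 0 := by
  refine Finset.sum_eq_zero fun j' _ => ?_
  have : (A.nbr j').filter (fun k => (k, j') ∈ ({(i, j)} : Finset (N × M))) = ∅ := by
    ext k
    simp only [Finset.mem_filter, Finset.mem_singleton, Prod.mk.injEq, Finset.notMem_empty,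
      iff_false]
    rintro ⟨h, rfl, rfl⟩
    exact hij h
  rw [this, A.f_empty]
  simp

theorem add_mem_poly_of_le_slack (hw : w ∈ A.poly) {y : N → M → ℝ≥0}
    (h : ∀ F : Finset (N × M), ∑ e ∈ F, (y e.1 e.2 : ℝ) ≤ A.slack w F) :
    (∀ i j, i ∉ A.nbr j → y i j = 0) ∧ w + y ∈ A.poly := by
  have h0 : ∀ i j, i ∉ A.nbr j → y i j = 0 := by
    intro i j hij
    have := h {(i, j)}
    rw [slack_singleton_eq A w hij, Finset.sum_singleton] at this
    exact le_antisymm (by exact_mod_cast this) zero_le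
  refine ⟨h0, fun i j hij => by simp [hw.1 i j hij, h0 i j hij], fun j F hF => ?_⟩
  have h1 := h (F ×ˢ {j})
  have h2 : A.slack w (F ×ˢ {j}) = A.f j F - ∑ k ∈ F, (w k j : ℝ) := by
    unfold slack
    rw [Finset.sum_eq_single j]
    · have : (A.nbr j).filter (fun k => (k, j) ∈ F ×ˢ ({j} : Finset M)) = F := by
        ext k
        simp only [Finset.mem_filter, Finset.mem_product, Finset.mem_singleton, and_true]
        exact ⟨fun h => h.2, fun h => ⟨hF h, h⟩⟩
      rw [this]
    · intro j' _ hj'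
      have : (A.nbr j').filter (fun k => (k, j') ∈ F ×ˢ ({j} : Finset M)) = ∅ := by
        ext k; simp [hj'.symm]
      rw [this, A.f_empty]
      simp
    · simp
  rw [h2, Finset.sum_product] at h1
  simp only [Finset.sum_singleton] at h1
  have h3 : ∑ k ∈ F, (w k j : ℝ) + ∑ k ∈ F, (y k j : ℝ) ≤ A.f j F := by linarith
  simp only [Pi.add_apply, Finset.sum_add_distrib]
  exact_mod_cast h3

end

/-- Augmentation of transactions `y` that can follow `w` towards `z`: edge by edge at the buyer
`i`, and in total for the others. -/
theorem exists_augment (A : Market N M) (w : N → M → ℝ≥0) (i : N) {y z : N → M → ℝ≥0}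
    (hy : w + y ∈ A.poly) (hz : w + z ∈ A.poly) :
    ∃ y' : N → M → ℝ≥0, w + y' ∈ A.poly ∧ (∀ j, y i j ≤ y' i j) ∧
      (∀ j, y' i j ≤ max (y i j) (z i j)) ∧
      (∀ k, k ≠ i → ∑ j, y k j ≤ ∑ j, y' k j) ∧
      (∀ k, k ≠ i → ∑ j, y' k j ≤ max (∑ j, y k j) (∑ j, z k j)) ∧
      ∑ k, ∑ j, z k j ≤ ∑ k, ∑ j, y' k j := by
  classical
  have hw : w ∈ A.poly := mem_poly_of_le (by intro k j; simp) hy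
  have off : ∀ {u : N → M → ℝ≥0}, w + u ∈ A.poly → ∀ i j, i ∉ A.nbr j → u i j = 0 := by
    intro u hu i j hij
    have := hu.1 i j hij
    simp only [Pi.add_apply, add_eq_zero] at this
    exact this.2
  -- The pairs at `i` stay separate while those of any other buyer merge: the granularity at which
  -- `others` looks at transactions.
  let π : N × M → M ⊕ N := fun e => if e.1 = i then Sum.inl e.2 else Sum.inr e.1
  have sum_inl : ∀ (u : N × M → ℝ) (j : M), ∑ e with π e = Sum.inl j, u e = u (i, j) := by
    intro u j
    have : Finset.univ.filter (fun e => π e = Sum.inl j) = {(i, j)} := by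
      ext ⟨k, j'⟩
      by_cases hk : k = i <;> simp [π, hk]
    rw [this, Finset.sum_singleton]
  have sum_inr : ∀ (u : N × M → ℝ) (k : N), k ≠ i →
      ∑ e with π e = Sum.inr k, u e = ∑ j, u (k, j) := by
    intro u k hk
    have : Finset.univ.filter (fun e => π e = Sum.inr k) = {k} ×ˢ Finset.univ := by
      ext ⟨k', j'⟩
      by_cases hk' : k' = i
      · simp [π, hk', hk]
      · simp [π, hk', eq_comm (a := k')]
    rw [this, Finset.sum_product, Finset.sum_singleton]
  obtain ⟨y', h0, h1, h2, h3, h4⟩ := exists_augment_map (A.slack_empty w)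
    (fun F => (Finset.sum_nonneg fun e _ => NNReal.coe_nonneg _).trans
      (A.sum_le_slack w (off hy) hy F)) (A.slack_submod w) π
    (y := fun e => (y e.1 e.2 : ℝ)) (z := fun e => (z e.1 e.2 : ℝ))
    (fun e => NNReal.coe_nonneg _) (fun e => NNReal.coe_nonneg _)
    (A.sum_le_slack w (off hy) hy) (A.sum_le_slack w (off hz) hz)
  lift y' to N × M → ℝ≥0 using h0
  refine ⟨fun k j => y' (k, j), (A.add_mem_poly_of_le_slack w hw h1).2, fun j => ?_, fun j => ?_,
    fun k hk => ?_, fun k hk => ?_, ?_⟩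
  · have := h2 (Sum.inl j)
    rw [sum_inl, sum_inl] at this
    exact_mod_cast this
  · have := h3 (Sum.inl j)
    rw [sum_inl, sum_inl, sum_inl] at this
    exact_mod_cast this
  · have := h2 (Sum.inr k)
    rw [sum_inr _ _ hk, sum_inr _ _ hk] at this
    exact_mod_cast this
  · have := h3 (Sum.inr k)
    rw [sum_inr _ _ hk, sum_inr _ _ hk, sum_inr _ _ hk] at this
    exact_mod_cast this
  · rw [Fintype.sum_prod_type, Fintype.sum_prod_type] at h4
    exact_mod_cast h4

end Market

/-! ### Demands, the clinching polytope, and rearranging future transactions -/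

theorem exists_le_sum_eq {M : Type*} [Fintype M] (a : M → ℝ≥0) {t : ℝ≥0} (ht : t ≤ ∑ j, a j) :
    ∃ b ≤ a, ∑ j, b j = t := by
  by_cases h : ∑ j, a j = 0
  · exact ⟨0, zero_le, by simpa [h, eq_comm] using ht⟩
  · refine ⟨fun j => a j * (t / ∑ j, a j), fun j => ?_, ?_⟩
    · exact mul_le_of_le_one_right zero_le (div_le_one_of_le₀ ht zero_le)
    · rw [← Finset.sum_mul, mul_div_cancel₀ _ h]

/-- Multiplied out, the budget condition needs no case for price zero: infinite demand there agrees
with `c * x = 0`. -/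
theorem le_demand_iff {c v x p : ℝ≥0} {B : ℝ≥0∞} (h : (p : ℝ≥0∞) ≤ B) :
    (x : ℝ≥0∞) ≤ demand c v B p ↔
      (c < v ∧ ((c * x + p : ℝ≥0) : ℝ≥0∞) ≤ B) ∨ (v ≤ c ∧ x = 0) := by
  unfold demand
  by_cases hcv : c < v
  · rw [if_pos hcv]
    simp only [hcv, true_and, not_le.2 hcv, false_and, or_false]
    by_cases hc : c = 0
    · simp [hc, h]
    · rw [if_neg hc, ENNReal.le_div_iff_mul_le (Or.inl (by simpa using hc)) (Or.inl (by simp)),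
        ENNReal.le_sub_iff_add_le_right (by simp) h]
      push_cast
      rw [mul_comm]
  · rw [if_neg hcv]
    simp [hcv, not_lt.1 hcv]

namespace Market

variable {N M : Type*} [DecidableEq N] [Fintype M] {A : Market N M} {w : N → M → ℝ≥0}
  {d : N → ℝ≥0∞} {i : N}

theorem remnant_of_le {y z : N → M → ℝ≥0} (h : y ≤ z) (hz : z ∈ A.remnant w d) :
    y ∈ A.remnant w d :=
  ⟨fun k j hk => le_antisymm (hz.1 k j hk ▸ h k j) zero_le,
    mem_poly_of_le (add_le_add le_rfl h) hz.2.1,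
    fun k => (ENNReal.coe_le_coe.2 (Finset.sum_le_sum fun j _ => h k j)).trans (hz.2.2 k)⟩

theorem zero_mem_remnant (hw : w ∈ A.poly) : 0 ∈ A.remnant w d :=
  ⟨fun _ _ _ => rfl, by simpa using hw, fun _ => by simp⟩

theorem mem_remnant_of_add_mem {y : N → M → ℝ≥0} (hy : w + y ∈ A.poly)
    (hd : ∀ k, ((∑ j, y k j : ℝ≥0) : ℝ≥0∞) ≤ d k) : y ∈ A.remnant w d := by
  refine ⟨fun k j hk => ?_, hy, hd⟩
  have := hy.1 k j hk
  simp only [Pi.add_apply, add_eq_zero] at this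
  exact this.2

/-- Deleting the row of `i` leaves the other totals unchanged. Hence the content of the clinching
condition is the reverse inclusion. -/
theorem others_subset (ξ : M → ℝ≥0) : A.others w d i ξ ⊆ A.others w d i 0 := by
  rintro u ⟨y, hy, -, hu⟩
  refine ⟨Function.update y i 0, remnant_of_le (fun k j => ?_) hy, by simp, fun k => ?_⟩
  · by_cases hk : k = i
    · subst hk; simp
    · simp [hk]
  · simpa [k.2] using hu k

theorem zero_mem_clinchPoly : 0 ∈ A.clinchPoly w d i := ⟨fun _ _ => rfl, rfl⟩

/-- If buyer `i` clinches `ξ`, the others can still get the same total transactions. -/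
theorem exists_row_eq {ξ : M → ℝ≥0} (hξ : ξ ∈ A.clinchPoly w d i) {y : N → M → ℝ≥0}
    (hy : y ∈ A.remnant w d) :
    ∃ y' ∈ A.remnant w d, y' i = ξ ∧ ∀ k, k ≠ i → ∑ j, y' k j = ∑ j, y k j := by
  have h : (fun k : {k // k ≠ i} => ∑ j, y k.1 j) ∈ A.others w d i 0 :=
    others_subset (y i) ⟨y, hy, rfl, fun _ => rfl⟩
  rw [← hξ.2] at h
  obtain ⟨y', h1, h2, h3⟩ := h
  exact ⟨y', h1, h2, fun k hk => h3 ⟨k, hk⟩⟩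

theorem sum_le_of_mem_clinchPoly (hw : w ∈ A.poly) {ξ : M → ℝ≥0} (hξ : ξ ∈ A.clinchPoly w d i) :
    ((∑ j, ξ j : ℝ≥0) : ℝ≥0∞) ≤ d i := by
  obtain ⟨y', h1, rfl, -⟩ := exists_row_eq hξ (zero_mem_remnant hw)
  exact h1.2.2 i

theorem update_mem_poly (hw : w ∈ A.poly) {ξ : M → ℝ≥0} (hξ : ξ ∈ A.clinchPoly w d i) :
    Function.update w i (w i + ξ) ∈ A.poly := by
  obtain ⟨y', h1, rfl, -⟩ := exists_row_eq hξ (zero_mem_remnant hw)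
  refine mem_poly_of_le (fun k j => ?_) h1.2.1
  by_cases hk : k = i
  · subst hk; simp
  · simp [hk]

variable [Fintype N]

/-- If buyer `i` clinches `ξ`, any possible future transactions can be rearranged to contain `ξ`
without reducing any total. -/
theorem exists_ge_row {ξ : M → ℝ≥0} (hξ : ξ ∈ A.clinchPoly w d i) {y : N → M → ℝ≥0}
    (hy : y ∈ A.remnant w d) :
    ∃ y' : N → M → ℝ≥0, w + y' ∈ A.poly ∧ ξ ≤ y' i ∧
      (∀ k, k ≠ i → ∑ j, y' k j = ∑ j, y k j) ∧ ∑ j, y i j ≤ ∑ j, y' i j := by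
  obtain ⟨y1, h1, rfl, h3⟩ := exists_row_eq hξ hy
  -- The totals of the other buyers agree in `y1` and `y`, so augmentation cannot move them; all
  -- that `y1` lacks in total is regained at `i`.
  obtain ⟨y2, g1, g2, -, g4, g5, g6⟩ := A.exists_augment w i h1.2.1 hy.2.1
  have e : ∀ k, k ≠ i → ∑ j, y2 k j = ∑ j, y k j := fun k hk =>
    le_antisymm (by simpa [h3 k hk] using g5 k hk) (by simpa [h3 k hk] using g4 k hk)
  refine ⟨y2, g1, g2, e, ?_⟩
  rw [← Finset.add_sum_erase _ _ (Finset.mem_univ i),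
    ← Finset.add_sum_erase _ _ (Finset.mem_univ i),
    Finset.sum_congr rfl fun k hk => e k (Finset.ne_of_mem_erase hk)] at g6
  exact le_of_add_le_add_right g6

theorem sum_le_supply (hw : w ∈ A.poly) (j : M) : ∑ k, w k j ≤ A.supply j := by
  refine le_trans (le_of_eq ?_) (hw.2 j _ subset_rfl)
  exact (Finset.sum_subset (Finset.subset_univ _) fun k _ hk => hw.1 k j hk).symm

theorem total_le (hw : w ∈ A.poly) : ∑ k, ∑ j, w k j ≤ ∑ j, A.supply j := by
  rw [Finset.sum_comm]
  exact Finset.sum_le_sum fun j _ => sum_le_supply hw j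

theorem total_add (w y : N → M → ℝ≥0) :
    ∑ k, ∑ j, (w + y) k j = ∑ k, ∑ j, w k j + ∑ k, ∑ j, y k j := by
  simp only [Pi.add_apply, Finset.sum_add_distrib]

/-- Future transactions that respect the demands and sell all goods. -/
def fullRemnant (A : Market N M) (w : N → M → ℝ≥0) (d : N → ℝ≥0∞) : Set (N → M → ℝ≥0) :=
  {y | y ∈ A.remnant w d ∧ ∑ k, ∑ j, w k j + ∑ k, ∑ j, y k j = ∑ j, A.supply j}

theorem total_eq_of_le {y z : N → M → ℝ≥0} (hy : y ∈ A.fullRemnant w d) (hz : w + z ∈ A.poly)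
    (h : ∑ k, ∑ j, y k j ≤ ∑ k, ∑ j, z k j) :
    ∑ k, ∑ j, w k j + ∑ k, ∑ j, z k j = ∑ j, A.supply j := by
  refine le_antisymm (total_add w z ▸ total_le hz) ?_
  rw [← hy.2]
  gcongr

/-- A version of `exists_ge_row` for transactions that sell all goods. -/
theorem exists_ge_row_full {ξ : M → ℝ≥0} (hξ : ξ ∈ A.clinchPoly w d i) {y : N → M → ℝ≥0}
    (hy : y ∈ A.fullRemnant w d) :
    ∃ y' ∈ A.fullRemnant w d, ξ ≤ y' i ∧ ∀ k, ∑ j, y' k j = ∑ j, y k j := by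
  obtain ⟨y', h1, h2, h3, h4⟩ := exists_ge_row hξ hy.1
  have hle : ∀ k, ∑ j, y k j ≤ ∑ j, y' k j := fun k => by
    by_cases hk : k = i
    · exact hk ▸ h4
    · exact (h3 k hk).ge
  have htot := total_eq_of_le hy h1 (Finset.sum_le_sum fun k _ => hle k)
  have hi : ∀ k, ∑ j, y' k j = ∑ j, y k j := by
    have := add_left_cancel (htot.trans hy.2.symm)
    exact fun k => (((Finset.sum_eq_sum_iff_of_le fun k _ => hle k).1 this.symm) k
      (Finset.mem_univ k)).symm
  exact ⟨y', ⟨mem_remnant_of_add_mem h1 fun k => hi k ▸ hy.1.2.2 k, htot⟩, h2, hi⟩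

theorem isClosed_remnant : IsClosed (A.remnant w d) := by
  have : A.remnant w d = (⋂ (k : N) (j : M) (_ : k ∉ A.nbr j), {y | y k j = 0}) ∩
      ((⋂ (j : M) (F : Finset N) (_ : F ⊆ A.nbr j),
        {y | ∑ k ∈ F, (w + y) k j ≤ A.f j F}) ∩
      ((⋂ (k : N) (j : M) (_ : k ∉ A.nbr j), {y | (w + y) k j = 0}) ∩
      ⋂ k : N, {y | ((∑ j, y k j : ℝ≥0) : ℝ≥0∞) ≤ d k})) := by
    ext y
    simp only [remnant, poly, Set.mem_ofPred_eq, Set.mem_inter_iff, Set.mem_iInter]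
    tauto
  rw [this]
  refine IsClosed.inter ?_ (IsClosed.inter ?_ (IsClosed.inter ?_ ?_))
  · exact isClosed_iInter fun k => isClosed_iInter fun j => isClosed_iInter fun _ =>
      isClosed_eq (by fun_prop) continuous_const
  · exact isClosed_iInter fun k => isClosed_iInter fun j => isClosed_iInter fun _ =>
      isClosed_le (by simp only [Pi.add_apply]; fun_prop) continuous_const
  · exact isClosed_iInter fun k => isClosed_iInter fun j => isClosed_iInter fun _ =>
      isClosed_eq (by simp only [Pi.add_apply]; fun_prop) continuous_const
  · exact isClosed_iInter fun k =>
      isClosed_le (ENNReal.continuous_coe.comp (by fun_prop)) continuous_const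

theorem isCompact_remnant : IsCompact (A.remnant w d) := by
  refine IsCompact.of_isClosed_subset
    (isCompact_Icc (a := (0 : N → M → ℝ≥0)) (b := fun k j => A.f j {k})) isClosed_remnant ?_
  intro y hy
  refine ⟨zero_le, fun k j => ?_⟩
  by_cases hk : k ∈ A.nbr j
  · have := hy.2.1.2 j {k} (by simpa using hk)
    rw [Finset.sum_singleton] at this
    exact le_trans (by simp) this
  · rw [hy.1 k j hk]; exact zero_le

/-- A vector is clinchable when every `u` reachable with row zero is reachable with this row. So the
polytope is an intersection of projections of compact slices, one per `u`. Compactness provides the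
maximal vectors without which `ClinchRule` promises nothing. -/
theorem isCompact_clinchPoly (hw : w ∈ A.poly) : IsCompact (A.clinchPoly w d i) := by
  have h1 : A.clinchPoly w d i = ⋂ u : A.others w d i 0,
      (fun y : N → M → ℝ≥0 => y i) ''
        {y | y ∈ A.remnant w d ∧ ∀ k : {k // k ≠ i}, ∑ j, y k.1 j = u.1 k} := by
    ext ξ
    simp only [Set.mem_iInter, Set.mem_image, Set.mem_ofPred_eq]
    constructor
    · rintro hξ ⟨u, hu⟩
      rw [← hξ.2] at hu
      obtain ⟨y, h1, h2, h3⟩ := hu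
      exact ⟨y, ⟨h1, h3⟩, h2⟩
    · intro h
      refine ⟨fun j hj => ?_, (others_subset ξ).antisymm fun u hu => ?_⟩
      · obtain ⟨y, h1, rfl⟩ := h ⟨fun _ => 0, 0, zero_mem_remnant hw, rfl, by simp⟩
        exact h1.1.1 i j hj
      · obtain ⟨y, h1, h2⟩ := h ⟨u, hu⟩
        exact ⟨y, h1.1, h2, h1.2⟩
  have hc : ∀ u : A.others w d i 0, IsCompact ((fun y : N → M → ℝ≥0 => y i) ''
        {y | y ∈ A.remnant w d ∧ ∀ k : {k // k ≠ i}, ∑ j, y k.1 j = u.1 k}) := by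
    intro u
    refine IsCompact.image ?_ (continuous_apply i)
    have : {y | y ∈ A.remnant w d ∧ ∀ k : {k // k ≠ i}, ∑ j, y k.1 j = u.1 k} =
        A.remnant w d ∩ ⋂ k : {k // k ≠ i}, {y | ∑ j, y k.1 j = u.1 k} := by
      ext y; simp
    rw [this]
    refine isCompact_remnant.inter_right ?_
    exact isClosed_iInter fun k => isClosed_eq (by fun_prop) continuous_const
  have u₀ : A.others w d i 0 := ⟨fun _ => 0, 0, zero_mem_remnant hw, rfl, by simp⟩
  rw [h1]
  exact (hc u₀).of_isClosed_subset (isClosed_iInter fun u => (hc u).isClosed)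
    (Set.iInter_subset _ u₀)

theorem exists_maximal_clinchPoly (hw : w ∈ A.poly) :
    ∃ ξ, Maximal (· ∈ A.clinchPoly w d i) ξ := by
  obtain ⟨ξ, hξ, hmax⟩ := (isCompact_clinchPoly hw).exists_isMaxOn ⟨0, zero_mem_clinchPoly⟩
    (f := fun ξ : M → ℝ≥0 => ∑ j, ξ j) (by fun_prop)
  refine ⟨ξ, hξ, fun ζ hζ hle => ?_⟩
  have h1 : ∑ j, ζ j ≤ ∑ j, ξ j := hmax hζ
  have h2 := (Finset.sum_eq_sum_iff_of_le fun j _ => hle j).1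
    (le_antisymm (Finset.sum_le_sum fun j _ => hle j) h1)
  exact fun j => (h2 j (Finset.mem_univ j)).ge

/-- After a maximal clinching of buyer `i`, the others can take all the remaining goods. -/
theorem exists_full_row_eq {ξ : M → ℝ≥0} (hξ : Maximal (· ∈ A.clinchPoly w d i) ξ)
    (hfull : (A.fullRemnant w d).Nonempty) : ∃ y ∈ A.fullRemnant w d, y i = ξ := by
  obtain ⟨y₀, hy₀⟩ := hfull
  obtain ⟨y₁, hy₁, hξy₁, -⟩ := exists_ge_row_full hξ.1 hy₀
  have hcomp : IsCompact (A.fullRemnant w d ∩ {y | ξ ≤ y i}) := by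
    refine IsCompact.inter_right (isCompact_remnant.inter_right ?_) ?_
    · exact isClosed_eq (by fun_prop) continuous_const
    · exact isClosed_le continuous_const (continuous_apply i)
  -- Let buyer `i` take as little as possible in a full future containing `ξ`. Her row then turns
  -- out to be clinchable, so maximality of `ξ` makes it equal to `ξ`.
  obtain ⟨y, ⟨hy, hξy⟩, hmin⟩ := hcomp.exists_isMinOn ⟨y₁, hy₁, hξy₁⟩
    (f := fun y : N → M → ℝ≥0 => ∑ j, y i j) (by fun_prop)
  refine ⟨y, hy, le_antisymm (hξ.2 ?_ hξy) hξy⟩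
  refine ⟨fun j hj => hy.1.1 i j hj, (others_subset _).antisymm ?_⟩
  rw [← hξ.1.2]
  rintro u ⟨z, hz, hzi, hzu⟩
  -- `z` has row `ξ` at `i`. Augmented towards `y` it sells all goods with a row between `ξ` and `y
  -- i`, so minimality makes that row `y i`.
  obtain ⟨y', g1, g2, g3, g4, g5, g6⟩ := A.exists_augment w i hz.2.1 hy.1.2.1
  rw [hzi] at g2 g3
  have g3' : y' i ≤ y i := fun j => (g3 j).trans (max_le (hξy j) le_rfl)
  have hfull' : y' ∈ A.fullRemnant w d := by
    refine ⟨mem_remnant_of_add_mem g1 fun k => ?_, total_eq_of_le hy g1 g6⟩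
    by_cases hk : k = i
    · subst hk
      exact (ENNReal.coe_le_coe.2 (Finset.sum_le_sum fun j _ => g3' j)).trans (hy.1.2.2 k)
    · refine (ENNReal.coe_le_coe.2 (g5 k hk)).trans ?_
      rcases max_choice (∑ j, z k j) (∑ j, y k j) with h | h <;> rw [h]
      exacts [hz.2.2 k, hy.1.2.2 k]
  have hle : ∑ j, y i j ≤ ∑ j, y' i j := hmin ⟨hfull', g2⟩
  have heq : y' i = y i := by
    ext1 j
    exact (Finset.sum_eq_sum_iff_of_le fun j _ => g3' j).1
      (le_antisymm (Finset.sum_le_sum fun j _ => g3' j) hle) j (Finset.mem_univ j)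
  -- The other rows are cut back to the totals prescribed by `z`.
  choose b hb1 hb2 using fun k : {k // k ≠ i} =>
    exists_le_sum_eq (y' k.1) (hzu k ▸ g4 k.1 k.2)
  refine ⟨fun k => if h : k = i then y i else b ⟨k, h⟩, remnant_of_le (fun k => ?_) hfull'.1,
    by simp, fun k => by simp [k.2, hb2 k]⟩
  by_cases h : k = i
  · subst h; simp [heq]
  · simpa [h] using hb1 ⟨k, h⟩

end Market

/-! ### One clinching or price rise: validity, selling out, potential -/

section Auction

variable {N M : Type*} [DecidableEq N] [Fintype N] [Fintype M] {A : Market N M} {rule : ClinchRule A}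
  {v : N → ℝ≥0} {B : N → ℝ≥0∞} {ε lam : ℝ≥0} {L : ℝ} {s : State N M}

/-- States with feasible transactions, payments within the budgets, and updated demands. -/
structure State.Valid (A : Market N M) (v : N → ℝ≥0) (B : N → ℝ≥0∞) (s : State N M) : Prop where
  mem_poly : s.w ∈ A.poly
  p_le : ∀ i, (s.p i : ℝ≥0∞) ≤ B i
  d_eq : ∀ i, s.d i = demand (s.c i) (v i) (B i) (s.p i)

theorem State.Valid.le_d_iff (hs : s.Valid A v B) {i : N} {x : ℝ≥0} :
    (x : ℝ≥0∞) ≤ s.d i ↔ (s.c i < v i ∧ ((s.c i * x + s.p i : ℝ≥0) : ℝ≥0∞) ≤ B i) ∨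
      (v i ≤ s.c i ∧ x = 0) := by
  rw [hs.d_eq, le_demand_iff (hs.p_le i)]

theorem initState_valid (hv : ∀ i, 0 < v i) : (initState N M).Valid A v B where
  mem_poly := ⟨fun _ _ _ => rfl, fun _ _ _ => by simp [initState]⟩
  p_le _ := by simp [initState]
  d_eq i := by simp [initState, demand, hv i]

theorem choose_maximal (hs : s.Valid A v B) (i : N) :
    Maximal (· ∈ A.clinchPoly s.w s.d i) (rule.choose s i) :=
  rule.maximal s i (Market.exists_maximal_clinchPoly hs.mem_poly)

theorem clinchBuyer_valid (hs : s.Valid A v B) (i : N) :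
    (clinchBuyer A rule v B s i).Valid A v B := by
  have hξ := (choose_maximal (rule := rule) hs i).1
  have hd := hs.le_d_iff.1 (Market.sum_le_of_mem_clinchPoly hs.mem_poly hξ)
  refine ⟨Market.update_mem_poly hs.mem_poly hξ, fun k => ?_, fun k => ?_⟩
  · by_cases hk : k = i
    · subst hk
      simp only [clinchBuyer, Function.update_self]
      rcases hd with ⟨-, hd⟩ | ⟨-, hd⟩
      · rwa [add_comm]
      · simpa [hd] using hs.p_le k
    · simpa [clinchBuyer, hk] using hs.p_le k
  · by_cases hk : k = i
    · subst hk
      simp [clinchBuyer]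
    · simpa [clinchBuyer, hk] using hs.d_eq k

/-- Future transactions that contain the clinched amounts remain possible after clinching. -/
theorem update_mem_remnant (hs : s.Valid A v B) {i : N} {y : N → M → ℝ≥0}
    (hy : y ∈ A.remnant s.w s.d) (hle : rule.choose s i ≤ y i) :
    Function.update y i (y i - rule.choose s i) ∈
      A.remnant (clinchBuyer A rule v B s i).w (clinchBuyer A rule v B s i).d := by
  have hs' := clinchBuyer_valid (rule := rule) hs i
  refine Market.mem_remnant_of_add_mem ?_ fun k => ?_
  · convert hy.2.1 using 1
    ext k j
    by_cases hk : k = i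
    · subst hk
      have := add_tsub_cancel_of_le (hle j)
      simp only [clinchBuyer, Pi.add_apply, Function.update_self, Pi.sub_apply]
      rw [add_assoc, this]
    · simp [clinchBuyer, hk]
  · by_cases hk : k = i
    · subst hk
      rw [hs'.le_d_iff]
      have hsum : ∑ j, (y k j - rule.choose s k j) + ∑ j, rule.choose s k j = ∑ j, y k j := by
        rw [← Finset.sum_add_distrib]
        exact Finset.sum_congr rfl fun j _ => tsub_add_cancel_of_le (hle j)
      simp only [clinchBuyer, Function.update_self, Pi.sub_apply]
      refine (hs.le_d_iff.1 (hy.2.2 k)).imp (fun h => ⟨h.1, ?_⟩) fun h => ⟨h.1, ?_⟩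
      · convert h.2 using 2
        rw [← hsum]
        ring
      · rw [← hsum] at h
        exact (add_eq_zero.1 h.2).1
    · simpa [clinchBuyer, hk] using hy.2.2 k

theorem sum_update_row (w : N → M → ℝ≥0) (i : N) (u : M → ℝ≥0) (k : N) :
    ∑ j, Function.update w i u k j = if k = i then ∑ j, u j else ∑ j, w k j := by
  by_cases hk : k = i
  · subst hk; simp
  · simp [hk]

theorem total_update_add (w : N → M → ℝ≥0) (i : N) (u : M → ℝ≥0) :
    ∑ k, ∑ j, Function.update w i (w i + u) k j = ∑ k, ∑ j, w k j + ∑ j, u j := by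
  simp only [sum_update_row]
  rw [← Finset.add_sum_erase _ _ (Finset.mem_univ i),
    ← Finset.add_sum_erase (Finset.univ : Finset N) (fun k => ∑ j, w k j) (Finset.mem_univ i),
    Finset.sum_congr rfl fun k hk => if_neg (Finset.ne_of_mem_erase hk)]
  simp only [if_true, Pi.add_apply, Finset.sum_add_distrib]
  ring

theorem update_mem_fullRemnant (hs : s.Valid A v B) {i : N} {y : N → M → ℝ≥0}
    (hy : y ∈ A.fullRemnant s.w s.d) (hle : rule.choose s i ≤ y i) :
    Function.update y i (y i - rule.choose s i) ∈
      A.fullRemnant (clinchBuyer A rule v B s i).w (clinchBuyer A rule v B s i).d := by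
  refine ⟨update_mem_remnant hs hy.1 hle, ?_⟩
  have h1 := total_update_add (Function.update y i (y i - rule.choose s i)) i (rule.choose s i)
  rw [Function.update_self, Function.update_idem, tsub_add_cancel_of_le hle,
    Function.update_eq_self] at h1
  have h2 := hy.2
  simp only [clinchBuyer]
  rw [total_update_add, ← h2, h1]
  ring

/-- After buyer `i` has clinched, all goods can be sold to the others. -/
theorem exists_full_row_zero (hs : s.Valid A v B) (i : N)
    (hfull : (A.fullRemnant s.w s.d).Nonempty) :
    ∃ y ∈ A.fullRemnant (clinchBuyer A rule v B s i).w (clinchBuyer A rule v B s i).d,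
      y i = 0 := by
  obtain ⟨y, hy, hyi⟩ := Market.exists_full_row_eq (choose_maximal (rule := rule) hs i) hfull
  exact ⟨_, update_mem_fullRemnant hs hy hyi.ge, by simp [hyi]⟩

/-- Rearranging around the clinch of `i` keeps all row totals, and a row of total zero vanishes. So
the others stay able to absorb everything without `k` while later buyers clinch. -/
theorem exists_full_row_zero_of_ne (hs : s.Valid A v B) {i k : N} (hk : k ≠ i)
    (h : ∃ y ∈ A.fullRemnant s.w s.d, y k = 0) :
    ∃ y ∈ A.fullRemnant (clinchBuyer A rule v B s i).w (clinchBuyer A rule v B s i).d,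
      y k = 0 := by
  obtain ⟨y, hy, hyk⟩ := h
  obtain ⟨y', hy', hle, hsum⟩ :=
    Market.exists_ge_row_full (choose_maximal (rule := rule) hs i).1 hy
  refine ⟨_, update_mem_fullRemnant hs hy' hle, ?_⟩
  have := hsum k
  simp only [hyk, Pi.zero_apply, Finset.sum_const_zero, Finset.sum_eq_zero_iff, Finset.mem_univ,
    true_imp_iff] at this
  rw [Function.update_of_ne hk]
  exact funext this

/-- A lower bound `L` on the sum of the value of the goods sold so far, the value at price `lam`
of the other goods, and what can be gained from selling these within the budgets. -/
def Potential (A : Market N M) (v : N → ℝ≥0) (B : N → ℝ≥0∞) (lam : ℝ≥0) (L : ℝ)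
    (s : State N M) : Prop :=
  ∃ y : N → M → ℝ≥0, s.w + y ∈ A.poly ∧
    (∀ k, ((v k * ∑ j, y k j + s.p k : ℝ≥0) : ℝ≥0∞) ≤ B k) ∧
    L ≤ ∑ k, (v k : ℝ) * (∑ j, s.w k j : ℝ≥0) +
      lam * ((∑ j, A.supply j : ℝ≥0) - (∑ k, ∑ j, s.w k j : ℝ≥0)) +
      ∑ k, max 0 ((v k : ℝ) - lam) * (∑ j, y k j : ℝ≥0)

theorem sum_sub_sum_eq_single {a b : N → ℝ} (i : N) (h : ∀ k, k ≠ i → a k = b k) :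
    ∑ k, a k - ∑ k, b k = a i - b i := by
  rw [← Finset.sum_sub_distrib]
  exact Finset.sum_eq_single i (fun k _ hk => by simp [h k hk]) (by simp)

/-- A clinched unit adds `v i`, costs `lam` as it is no longer unsold, and removes at most `v i -
lam` from the planned part. Here `lam ≤ v i`, since nothing is clinched once the clock has reached
`v i`. The price paid is below `v i`, so the rest of the plan stays affordable. -/
theorem Potential.clinchBuyer (hpot : Potential A v B lam L s) (hs : s.Valid A v B) (i : N)
    (hc : ∀ k, s.c k ≤ lam) (hlam : ∀ k, s.c k < v k → lam ≤ v k) :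
    Potential A v B lam L (clinchBuyer A rule v B s i) := by
  obtain ⟨y, hy, hyB, hL⟩ := hpot
  -- Buyers with zero demand leave the plan; their value is at most `lam`, so their coefficient is
  -- zero.
  let y₀ : N → M → ℝ≥0 := fun k => if s.c k < v k then y k else 0
  have hy₀le : ∀ k, y₀ k ≤ y k := fun k => by
    by_cases h : s.c k < v k <;> simp [y₀, h]
  have hy₀sum : ∀ k, ∑ j, y₀ k j ≤ ∑ j, y k j := fun k =>
    Finset.sum_le_sum fun j _ => hy₀le k j
  have hy₀ : y₀ ∈ A.remnant s.w s.d := by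
    refine Market.mem_remnant_of_add_mem (Market.mem_poly_of_le
      (add_le_add le_rfl hy₀le) hy) fun k => ?_
    rw [hs.le_d_iff]
    by_cases h : s.c k < v k
    · refine Or.inl ⟨h, le_trans (ENNReal.coe_le_coe.2 ?_) (hyB k)⟩
      have := hy₀sum k
      gcongr
    · exact Or.inr ⟨not_lt.1 h, by simp [y₀, h]⟩
  have hcoef : ∀ k, max 0 ((v k : ℝ) - lam) * (∑ j, y₀ k j : ℝ≥0) =
      max 0 ((v k : ℝ) - lam) * (∑ j, y k j : ℝ≥0) := by
    intro k
    by_cases h : s.c k < v k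
    · simp [y₀, h]
    · have h1 : v k ≤ lam := (not_lt.1 h).trans (hc k)
      have h2 : (v k : ℝ) ≤ lam := by exact_mod_cast h1
      rw [max_eq_left (by linarith)]
      simp
  have hξ := (choose_maximal (rule := rule) hs i).1
  obtain ⟨ξ, hξdef⟩ : ∃ ξ, ξ = rule.choose s i := ⟨_, rfl⟩
  rw [← hξdef] at hξ
  have hξd := hs.le_d_iff.1 (Market.sum_le_of_mem_clinchPoly hs.mem_poly hξ)
  obtain ⟨y', hy', hξy', hrow, hi⟩ := Market.exists_ge_row hξ hy₀
  -- The plan of `i` shrinks by the clinched amount; truncated subtraction covers clinching more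
  -- than was planned.
  obtain ⟨u, hu, husum⟩ := exists_le_sum_eq (y' i - ξ) (t := ∑ j, y₀ i j - ∑ j, ξ j) (by
    rw [tsub_le_iff_right]
    refine hi.trans (le_of_eq ?_)
    rw [← Finset.sum_add_distrib]
    exact Finset.sum_congr rfl fun j _ => (tsub_add_cancel_of_le (hξy' j)).symm)
  have hwi : (TwoSided.clinchBuyer A rule v B s i).w = Function.update s.w i (s.w i + ξ) := by
    rw [hξdef]; rfl
  have hysum : ∀ k, ∑ j, Function.update y' i u k j =
      if k = i then ∑ j, y₀ i j - ∑ j, ξ j else ∑ j, y₀ k j := by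
    intro k
    rw [sum_update_row, husum]
    split_ifs with hk
    · rfl
    · exact hrow k hk
  refine ⟨Function.update y' i u, ?_, fun k => ?_, hL.trans ?_⟩
  · refine Market.mem_poly_of_le (fun k j => ?_) hy'
    rw [hwi]
    by_cases hk : k = i
    · subst hk
      simp only [Pi.add_apply, Function.update_self]
      have h1 := hu j
      have h2 := tsub_add_cancel_of_le (hξy' j)
      rw [← h2, add_assoc, add_comm (y' k j - ξ j)]
      gcongr
      exact h1
    · simp [hk]
  · rw [hysum]
    by_cases hk : k = i
    · subst hk
      simp only [TwoSided.clinchBuyer, Function.update_self, if_true, ← hξdef]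
      rcases hξd with ⟨hcv, hξB⟩ | ⟨hcv, hξ0⟩
      · rcases le_total (∑ j, y₀ k j) (∑ j, ξ j) with h | h
        · rw [tsub_eq_zero_of_le h, mul_zero, zero_add, add_comm]
          exact hξB
        · refine le_trans (ENNReal.coe_le_coe.2 ?_) (hyB k)
          have h1 : ∑ j, y₀ k j - ∑ j, ξ j + ∑ j, ξ j ≤ ∑ j, y k j := by
            rw [tsub_add_cancel_of_le h]; exact hy₀sum k
          calc v k * (∑ j, y₀ k j - ∑ j, ξ j) + (s.p k + s.c k * ∑ j, ξ j)
              ≤ v k * (∑ j, y₀ k j - ∑ j, ξ j) + (s.p k + v k * ∑ j, ξ j) := by gcongr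
            _ = v k * (∑ j, y₀ k j - ∑ j, ξ j + ∑ j, ξ j) + s.p k := by ring
            _ ≤ _ := by gcongr
      · have : y₀ k = 0 := if_neg (not_lt.2 hcv)
        simpa [hξ0, this] using hs.p_le k
    · simp only [TwoSided.clinchBuyer, Function.update_of_ne hk, if_neg hk]
      refine le_trans (ENNReal.coe_le_coe.2 ?_) (hyB k)
      have := hy₀sum k
      gcongr
  · rw [hwi, total_update_add]
    have h1 := sum_sub_sum_eq_single i
      (a := fun k => (v k : ℝ) * (∑ j, Function.update s.w i (s.w i + ξ) k j : ℝ≥0))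
      (b := fun k => (v k : ℝ) * (∑ j, s.w k j : ℝ≥0)) (fun k hk => by
        simp [hk])
    have h2 := sum_sub_sum_eq_single i
      (a := fun k => max 0 ((v k : ℝ) - lam) * (∑ j, Function.update y' i u k j : ℝ≥0))
      (b := fun k => max 0 ((v k : ℝ) - lam) * (∑ j, y k j : ℝ≥0)) (fun k hk => by
        rw [hysum, if_neg hk, hcoef])
    simp only [hysum, sum_update_row, if_true, Pi.add_apply, Finset.sum_add_distrib,
      NNReal.coe_add] at h1 h2 ⊢
    rw [← hcoef] at h2
    have h3 : ((∑ j, y₀ i j : ℝ≥0) : ℝ) - (∑ j, ξ j : ℝ≥0) ≤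
        (∑ j, y₀ i j - ∑ j, ξ j : ℝ≥0) := NNReal.coe_sub_def ▸ le_max_left _ _
    have h4 := mul_le_mul_of_nonneg_left h3 (le_max_left 0 ((v i : ℝ) - lam))
    have h5 : ((v i : ℝ) - lam) * (∑ j, ξ j : ℝ≥0) =
        max 0 ((v i : ℝ) - lam) * (∑ j, ξ j : ℝ≥0) := by
      rcases hξd with ⟨hcv, -⟩ | ⟨-, hξ0⟩
      · have : (lam : ℝ) ≤ v i := by exact_mod_cast hlam i hcv
        rw [max_eq_right (by linarith)]
      · simp [hξ0]
    nlinarith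

/-- Every unsold unit gains `ε`, every planned unit loses at most `ε`, and planned units are among
the unsold ones. -/
theorem Potential.add_price (hpot : Potential A v B lam L s) :
    Potential A v B (lam + ε) L s := by
  obtain ⟨y, hy, hyB, hL⟩ := hpot
  refine ⟨y, hy, hyB, hL.trans ?_⟩
  have h1 := Market.total_le hy
  rw [Market.total_add] at h1
  have h2 : ((∑ k, ∑ j, s.w k j : ℝ≥0) : ℝ) + (∑ k, ∑ j, y k j : ℝ≥0) ≤
      (∑ j, A.supply j : ℝ≥0) := by exact_mod_cast h1
  have h3 : ∑ k, max 0 ((v k : ℝ) - lam) * (∑ j, y k j : ℝ≥0) ≤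
      ∑ k, (max 0 ((v k : ℝ) - (lam + ε : ℝ≥0)) * (∑ j, y k j : ℝ≥0) +
        ε * (∑ j, y k j : ℝ≥0)) := by
    refine Finset.sum_le_sum fun k _ => ?_
    rw [← add_mul]
    refine mul_le_mul_of_nonneg_right ?_ (NNReal.coe_nonneg _)
    push_cast
    refine max_le (add_nonneg (le_max_left _ _) ε.2) ?_
    have := le_max_right 0 ((v k : ℝ) - (lam + ε))
    linarith
  rw [Finset.sum_add_distrib, ← Finset.mul_sum, ← NNReal.coe_sum] at h3
  have h4 := mul_le_mul_of_nonneg_left h2 ε.2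
  have h5 : ((lam + ε : ℝ≥0) : ℝ) = lam + ε := NNReal.coe_add _ _
  rw [h5] at h3 ⊢
  simp only [NNReal.val_eq_coe] at h4
  linarith

/-- Cut `w` to `y` so that `v k` times the total of row `k` is exactly the capped value. As `lam ≤ v
k`, this value splits into parts at `lam` and at `v k - lam` per unit, and the units of `y` do not
exceed the supply. -/
theorem potential_initState (hv : ∀ i, 0 < v i) (hle : ∀ i, lam ≤ v i) {w : N → M → ℝ≥0}
    (hw : w ∈ A.poly) :
    Potential A v B lam (∑ k, (min ((v k * ∑ j, w k j : ℝ≥0) : ℝ≥0∞) (B k)).toReal)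
      (initState N M) := by
  have hfin : ∀ k, min ((v k * ∑ j, w k j : ℝ≥0) : ℝ≥0∞) (B k) ≠ ⊤ := fun k =>
    ne_top_of_le_ne_top ENNReal.coe_ne_top (min_le_left _ _)
  have ht : ∀ k, (min ((v k * ∑ j, w k j : ℝ≥0) : ℝ≥0∞) (B k)).toNNReal / v k ≤
      ∑ j, w k j := by
    intro k
    refine div_le_of_le_mul₀ zero_le zero_le ?_
    rw [mul_comm (∑ j, w k j), ← ENNReal.coe_le_coe, ENNReal.coe_toNNReal (hfin k)]
    exact min_le_left _ _
  choose y hyle hysum using fun k => exists_le_sum_eq (w k) (ht k)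
  have hvy : ∀ k, v k * ∑ j, y k j =
      (min ((v k * ∑ j, w k j : ℝ≥0) : ℝ≥0∞) (B k)).toNNReal := fun k => by
    rw [hysum, mul_div_cancel₀ _ (hv k).ne']
  have hy : y ∈ A.poly := Market.mem_poly_of_le hyle hw
  have h0 : (initState N M).w + y = y := by ext; simp [initState]
  refine ⟨y, h0.symm ▸ hy, fun k => ?_, ?_⟩
  · rw [hvy]
    simp only [initState, add_zero]
    rw [ENNReal.coe_toNNReal (hfin k)]
    exact min_le_right _ _
  · have h1 : ((∑ k, ∑ j, y k j : ℝ≥0) : ℝ) ≤ (∑ j, A.supply j : ℝ≥0) := by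
      exact_mod_cast Market.total_le hy
    have h2 : ∑ k, (min ((v k * ∑ j, w k j : ℝ≥0) : ℝ≥0∞) (B k)).toReal =
        ∑ k, ((max 0 ((v k : ℝ) - lam)) * (∑ j, y k j : ℝ≥0) + lam * (∑ j, y k j : ℝ≥0)) := by
      refine Finset.sum_congr rfl fun k _ => ?_
      have h3 : (lam : ℝ) ≤ v k := by exact_mod_cast hle k
      rw [max_eq_right (by linarith), ENNReal.toReal, ← hvy]
      push_cast
      ring
    rw [h2, Finset.sum_add_distrib, ← Finset.mul_sum, ← NNReal.coe_sum]
    have h4 := mul_le_mul_of_nonneg_left h1 (NNReal.coe_nonneg lam)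
    simp only [initState, Finset.sum_const_zero, NNReal.coe_zero, mul_zero]
    linarith

end Auction

/-! ### The run of the auction: rounds, termination, welfare at the end -/

section Auction

variable {N M : Type*} [DecidableEq N] [Fintype N] [Fintype M] {A : Market N M}
  {rule : ClinchRule A} {v : N → ℝ≥0} {B : N → ℝ≥0∞} {ε lam : ℝ≥0} {L : ℝ} {s : State N M}
  {order : List N}

/-- The properties of a state that clinching preserves at fixed clocks. -/
structure State.Sound (A : Market N M) (v : N → ℝ≥0) (B : N → ℝ≥0∞) (lam : ℝ≥0) (L : ℝ)
    (s : State N M) : Prop where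
  valid : s.Valid A v B
  full : (A.fullRemnant s.w s.d).Nonempty
  potential : Potential A v B lam L s

/-- The last clause prepares the price rise: whichever buyer's demand falls next, all goods can
still be sold to the others. The hypotheses on the clocks persist because clinching leaves them
fixed. -/
theorem State.Sound.clinching (hs : s.Sound A v B lam L) (hc : ∀ k, s.c k ≤ lam)
    (hlam : ∀ k, s.c k < v k → lam ≤ v k) (order : List N) :
    (clinching A rule v B order s).Sound A v B lam L ∧
      (clinching A rule v B order s).c = s.c ∧ (clinching A rule v B order s).l = s.l ∧
      ∀ i ∈ order, ∃ y ∈ A.fullRemnant (clinching A rule v B order s).w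
        (clinching A rule v B order s).d, y i = 0 := by
  induction order using List.reverseRecOn with
  | nil => exact ⟨hs, rfl, rfl, by simp⟩
  | append_singleton order i ih =>
    obtain ⟨h1, h2, h3, h4⟩ := ih
    have e : TwoSided.clinching A rule v B (order ++ [i]) s =
        clinchBuyer A rule v B (TwoSided.clinching A rule v B order s) i := by
      simp [TwoSided.clinching]
    rw [e]
    have hi := exists_full_row_zero (rule := rule) h1.valid i h1.full
    refine ⟨⟨clinchBuyer_valid h1.valid i, ?_, h1.potential.clinchBuyer h1.valid i
      (h2 ▸ hc) (h2 ▸ hlam)⟩, h2, h3, fun k hk => ?_⟩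
    · obtain ⟨y, hy, -⟩ := hi
      exact ⟨y, hy⟩
    · by_cases hki : k = i
      · exact hki ▸ hi
      · refine exists_full_row_zero_of_ne h1.valid hki (h4 k ?_)
        simpa [hki] using hk

/-- The state in round `R` when the price clocks of the first `s.l` buyers have already increased
in this round. -/
def State.Clock (ε : ℝ≥0) (order : List N) (R : ℕ) (s : State N M) : Prop :=
  ∀ q i, order[q]? = some i → s.c i = if q < s.l then ((R + 1 : ℕ) : ℝ≥0) * ε else R * ε

theorem State.Clock.le {R : ℕ} (h : s.Clock ε order R) (hmem : ∀ i, i ∈ order) (k : N) :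
    s.c k ≤ ((R + 1 : ℕ) : ℝ≥0) * ε := by
  obtain ⟨q, hq⟩ := List.mem_iff_getElem?.1 (hmem k)
  rw [h q k hq]
  split_ifs
  · exact le_rfl
  · gcongr; simp

/-- A multiple of `ε` above `R * ε` is at least `(R + 1) * ε`. So the price of the round, though
ahead of the lagging clocks, is still at most the value of every active buyer. -/
theorem State.Clock.le_of_lt {R : ℕ} (h : s.Clock ε order R) (hmem : ∀ i, i ∈ order)
    (hv : ∀ i, v i ∈ posMultiples ε) (k : N) (hk : s.c k < v k) :
    ((R + 1 : ℕ) : ℝ≥0) * ε ≤ v k := by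
  obtain ⟨q, hq⟩ := List.mem_iff_getElem?.1 (hmem k)
  rw [h q k hq] at hk
  split_ifs at hk
  · exact hk.le
  · obtain ⟨-, m, hm⟩ := hv k
    rw [hm] at hk ⊢
    have := lt_of_mul_lt_mul_right hk zero_le
    gcongr
    exact_mod_cast this

/-- The properties of a state that iterations preserve. -/
structure State.Running (A : Market N M) (v : N → ℝ≥0) (B : N → ℝ≥0∞) (ε : ℝ≥0)
    (order : List N) (L : ℝ) (R : ℕ) (s : State N M) : Prop where
  sound : s.Sound A v B (((R + 1 : ℕ) : ℝ≥0) * ε) L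
  lt : s.l < order.length
  clock : s.Clock ε order R

/-- The price in the potential grows only when the position wraps around. The equation counts
iterations as full rounds plus position, which later yields termination. -/
theorem State.Running.iteration {R : ℕ} (hs : s.Running A v B ε order L R)
    (hmem : ∀ i, i ∈ order) (hnd : order.Nodup) (hv : ∀ i, v i ∈ posMultiples ε) :
    ∃ R', (iteration A rule v B ε order s).Running A v B ε order L R' ∧
      R' * order.length + (iteration A rule v B ε order s).l = R * order.length + s.l + 1 := by
  obtain ⟨h1, h2, h3, h4⟩ := hs.sound.clinching (rule := rule) (hs.clock.le hmem)
    (hs.clock.le_of_lt hmem hv) order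
  obtain ⟨s', hs'⟩ : ∃ s', s' = clinching A rule v B order s := ⟨_, rfl⟩
  rw [← hs'] at h1 h2 h3 h4
  have hl : s'.l < order.length := h3 ▸ hs.lt
  obtain ⟨i, hi⟩ : ∃ i, order[s'.l]? = some i := ⟨_, List.getElem?_eq_getElem hl⟩
  have hit : TwoSided.iteration A rule v B ε order s =
    { c := Function.update s'.c i (s'.c i + ε)
      d := Function.update s'.d i (demand (s'.c i + ε) (v i) (B i) (s'.p i))
      p := s'.p
      r := s'.r
      w := s'.w
      l := (s'.l + 1) % order.length } := by
    unfold TwoSided.iteration raisePrice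
    rw [← hs', hi]
  rw [hit]
  have hclock : s'.Clock ε order R := fun q k hq => by rw [h2, h3]; exact hs.clock q k hq
  have hvalid : State.Valid A v B
      { c := Function.update s'.c i (s'.c i + ε)
        d := Function.update s'.d i (demand (s'.c i + ε) (v i) (B i) (s'.p i))
        p := s'.p
        r := s'.r
        w := s'.w
        l := (s'.l + 1) % order.length } := by
    refine ⟨h1.valid.mem_poly, h1.valid.p_le, fun k => ?_⟩
    by_cases hk : k = i
    · subst hk; simp
    · simpa [hk] using h1.valid.d_eq k
  have hfull : (A.fullRemnant s'.w
      (Function.update s'.d i (demand (s'.c i + ε) (v i) (B i) (s'.p i)))).Nonempty := by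
    -- Only the demand of `i` changes, and `y` gives her nothing.
    obtain ⟨y, hy, hyi⟩ := h4 i (List.mem_of_getElem? hi)
    refine ⟨y, ⟨hy.1.1, hy.1.2.1, fun k => ?_⟩, hy.2⟩
    by_cases hk : k = i
    · subst hk; simp [hyi]
    · simpa [hk] using hy.1.2.2 k
  have hupd : ∀ q k, order[q]? = some k → Function.update s'.c i (s'.c i + ε) k =
      if q < s'.l + 1 then ((R + 1 : ℕ) : ℝ≥0) * ε else R * ε := by
    intro q k hq
    by_cases hk : k = i
    · subst hk
      have hqk : q = s'.l := by
        obtain ⟨hq1, hq2⟩ := List.getElem?_eq_some_iff.1 hq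
        obtain ⟨hl1, hl2⟩ := List.getElem?_eq_some_iff.1 hi
        exact (hnd.getElem_inj_iff).1 (hq2.trans hl2.symm)
      rw [Function.update_self, hclock _ _ hq]
      simp only [hqk, lt_irrefl, if_false, Nat.lt_succ_self, if_true]
      push_cast
      ring
    · have hqk : q ≠ s'.l := by
        rintro rfl
        exact hk (Option.some_injective _ (hq.symm.trans hi))
      rw [Function.update_of_ne hk, hclock _ _ hq]
      exact if_congr (by omega) rfl rfl
  by_cases hlast : s'.l + 1 = order.length
  · refine ⟨R + 1, ⟨⟨hvalid, hfull, ?_⟩, ?_, fun q k hq => ?_⟩, ?_⟩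
    · have := h1.potential.add_price (ε := ε)
      have e : ((R + 1 : ℕ) : ℝ≥0) * ε + ε = ((R + 1 + 1 : ℕ) : ℝ≥0) * ε := by push_cast; ring
      rw [e] at this
      exact this
    · exact Nat.mod_lt _ (by omega)
    · have hql : q < s'.l + 1 := by
        obtain ⟨hq1, -⟩ := List.getElem?_eq_some_iff.1 hq
        omega
      simp only [hlast, Nat.mod_self, not_lt_zero, if_false]
      rw [hupd q k hq, if_pos hql]
    · simp only [hlast, Nat.mod_self]
      rw [← h3, add_assoc, hlast]
      ring
  · have hmod : (s'.l + 1) % order.length = s'.l + 1 := Nat.mod_eq_of_lt (by omega)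
    refine ⟨R, ⟨⟨hvalid, hfull, h1.potential⟩, ?_, fun q k hq => ?_⟩, ?_⟩
    · simp only [hmod]; omega
    · simp only [hmod]
      exact hupd q k hq
    · simp only [hmod]; omega

/-- The auction sells all goods, and its social welfare is at least the liquid welfare of any
feasible transactions that sell all goods. -/
theorem finalState_welfare (hv : ∀ i, v i ∈ posMultiples ε) (hmem : ∀ i, i ∈ order)
    (hnd : order.Nodup) (hne : order ≠ []) {w : N → M → ℝ≥0} (hw : w ∈ A.poly)
    (hwfull : ∑ k, ∑ j, w k j = ∑ j, A.supply j) :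
    (finalState A rule v B ε order).w ∈ A.poly ∧
      ∑ k, ∑ j, (finalState A rule v B ε order).w k j = ∑ j, A.supply j ∧
      ∑ k, (min ((v k * ∑ j, w k j : ℝ≥0) : ℝ≥0∞) (B k)).toReal ≤
        ∑ k, (v k : ℝ) * (∑ j, (finalState A rule v B ε order).w k j : ℝ≥0) := by
  obtain ⟨L, hL⟩ : ∃ L, L = ∑ k, (min ((v k * ∑ j, w k j : ℝ≥0) : ℝ≥0∞) (B k)).toReal :=
    ⟨_, rfl⟩
  have hpos : ∀ i, 0 < v i := fun i => (hv i).1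
  have hlen : 0 < order.length := List.length_pos_iff.2 hne
  have hinit : (initState N M).Running A v B ε order L 0 := by
    have hle : ∀ i, ((0 + 1 : ℕ) : ℝ≥0) * ε ≤ v i := by
      intro i
      obtain ⟨h0, m, hm⟩ := hv i
      have : m ≠ 0 := by
        rintro rfl
        simp [hm] at h0
      rw [hm]
      gcongr
      omega
    refine ⟨⟨initState_valid hpos, ⟨w, ⟨hw.1, ?_, fun k => by simp [initState]⟩, ?_⟩, ?_⟩,
      by simpa [initState] using hlen, fun q i _ => by simp [initState]⟩
    · convert hw using 1
      ext k j
      simp [initState]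
    · simpa [initState] using hwfull
    · rw [hL]
      exact potential_initState hpos hle hw
  have hrun : ∀ t : ℕ, ∃ R, ((iteration A rule v B ε order)^[t] (initState N M)).Running
      A v B ε order L R ∧
      R * order.length + ((iteration A rule v B ε order)^[t] (initState N M)).l = t := by
    intro t
    induction t with
    | zero => exact ⟨0, hinit, by simp [initState]⟩
    | succ t ih =>
      obtain ⟨R, h1, h2⟩ := ih
      obtain ⟨R', h3, h4⟩ := h1.iteration (rule := rule) hmem hnd hv
      rw [Function.iterate_succ_apply']
      exact ⟨R', h3, by rw [h4, h2]⟩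
  have hterm : {t : ℕ | ∀ i,
      ((iteration A rule v B ε order)^[t] (initState N M)).d i = 0}.Nonempty := by
    choose _ m hm using hv
    -- With `v i = m i * ε`, after `∑ i, m i` rounds every clock has reached its buyer's value.
    refine ⟨(∑ i, m i) * order.length, fun i => ?_⟩
    obtain ⟨R, h1, h2⟩ := hrun ((∑ i, m i) * order.length)
    have hR : ∑ i, m i ≤ R := by
      by_contra hlt
      have h3 : (R + 1) * order.length ≤ (∑ i, m i) * order.length :=
        Nat.mul_le_mul_right _ (not_le.1 hlt)
      have := h1.lt
      rw [add_mul, one_mul] at h3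
      omega
    have hmi : m i ≤ R := (Finset.single_le_sum (fun _ _ => Nat.zero_le _)
      (Finset.mem_univ i)).trans hR
    rw [h1.sound.valid.d_eq, demand, if_neg]
    rw [not_lt, hm]
    obtain ⟨q, hq⟩ := List.mem_iff_getElem?.1 (hmem i)
    rw [h1.clock q i hq]
    split_ifs
    · gcongr; omega
    · gcongr
  obtain ⟨R, hfin, -⟩ := hrun (sInf {t : ℕ | ∀ i,
    ((iteration A rule v B ε order)^[t] (initState N M)).d i = 0})
  have hd := Nat.sInf_mem hterm
  change ∀ i, (finalState A rule v B ε order).d i = 0 at hd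
  change (finalState A rule v B ε order).Running A v B ε order L R at hfin
  obtain ⟨s, hs⟩ : ∃ s, s = finalState A rule v B ε order := ⟨_, rfl⟩
  rw [← hs] at hd hfin ⊢
  obtain ⟨y, hy, hyfull⟩ := hfin.sound.full
  have hy0 : ∀ k, ∑ j, y k j = 0 := by
    intro k
    have := hy.2.2 k
    rw [hd k] at this
    exact_mod_cast le_antisymm this zero_le
  simp only [hy0, Finset.sum_const_zero, add_zero] at hyfull
  refine ⟨hfin.sound.valid.mem_poly, hyfull, ?_⟩
  obtain ⟨z, hz, -, hLz⟩ := hfin.sound.potential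
  -- Everything is sold, so the planned part of the potential is empty and the bound is on the value
  -- sold alone.
  have hz0 : ∀ k, ∑ j, z k j = 0 := by
    have h1 := Market.total_le hz
    rw [Market.total_add, hyfull] at h1
    have h2 : ∑ k, ∑ j, z k j = 0 := by simpa using h1
    intro k
    exact Finset.sum_eq_zero_iff.1 h2 k (Finset.mem_univ k)
  simp only [hz0, hyfull, sub_self, mul_zero, NNReal.coe_zero, Finset.sum_const_zero,
    add_zero] at hLz
  rw [← hL]
  exact hLz

end Auction

/-! ### Virtual buyers, and the mechanism run on both orders of the profiles -/

section Mechanisms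

variable {N M : Type*} [Fintype N] [Fintype M] [LinearOrder N] [LinearOrder M]

theorem mem_buyerOrder (i : N ⊕ M) : i ∈ buyerOrder N M := by
  rcases i with i | j <;> simp [buyerOrder]

theorem nodup_buyerOrder : (buyerOrder N M).Nodup := by
  refine List.Nodup.append ((Finset.sort_nodup _ _).map Sum.inl_injective)
    ((Finset.sort_nodup _ _).map Sum.inr_injective) ?_
  intro x hx hy
  simp only [List.mem_map] at hx hy
  obtain ⟨a, -, rfl⟩ := hx
  obtain ⟨b, -, hb⟩ := hy
  exact Sum.inr_ne_inl hb

theorem supply_withVirtual (A : Market N M) (j : M) : A.withVirtual.supply j = A.supply j := by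
  simp [Market.supply, Market.withVirtual]

/-- The transactions in which the virtual buyers take all the remaining goods. -/
def extendVirtual (A : Market N M) (w : N → M → ℝ≥0) : N ⊕ M → M → ℝ≥0 :=
  Sum.elim w fun k j => if k = j then A.supply j - ∑ i, w i j else 0

theorem sum_extendVirtual {A : Market N M} {w : N → M → ℝ≥0} (hw : w ∈ A.poly) (j : M) :
    ∑ k, extendVirtual A w k j = A.supply j := by
  rw [Fintype.sum_sum_type]
  simp only [extendVirtual, Sum.elim_inl, Sum.elim_inr, Finset.sum_ite_eq', Finset.mem_univ,
    if_true]
  exact add_tsub_cancel_of_le (Market.sum_le_supply hw j)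

theorem extendVirtual_mem_poly {A : Market N M} {w : N → M → ℝ≥0} (hw : w ∈ A.poly) :
    extendVirtual A w ∈ A.withVirtual.poly := by
  refine ⟨fun k j hk => ?_, fun j F hF => ?_⟩
  · rcases k with i | k
    · exact hw.1 i j (by simpa [Market.withVirtual] using hk)
    · have : k ≠ j := by simpa [Market.withVirtual] using hk
      simp [extendVirtual, this]
  · by_cases h : Sum.inr j ∈ F
    · have e : A.withVirtual.f j F = A.supply j := by simp [Market.withVirtual, h, Market.supply]
      rw [e, ← sum_extendVirtual hw j]
      exact Finset.sum_le_sum_of_subset (Finset.subset_univ F)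
    · have e : A.withVirtual.f j F = A.f j F.toLeft := by simp [Market.withVirtual, h]
      have hl : F.toLeft ⊆ A.nbr j := by
        intro i hi
        have := hF (Finset.mem_toLeft.1 hi)
        simpa [Market.withVirtual] using this
      rw [e]
      refine le_trans (le_of_eq ?_) (hw.2 j _ hl)
      have hF' : F = F.toLeft.map ⟨Sum.inl, Sum.inl_injective⟩ := by
        ext k
        rcases k with i | k
        · simp
        · simp only [Finset.mem_map, Function.Embedding.coeFn_mk, reduceCtorEq, and_false,
            exists_false, iff_false]
          intro hk
          have hkj : k = j := by simpa [Market.withVirtual] using hF hk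
          exact h (hkj ▸ hk)
      conv_lhs => rw [hF']
      simp [extendVirtual]

/-- A virtual buyer has no budget cap, so her value for the leftover goods is the seller's term in
`LW`. As the auction sells out, cancelling the virtual trades returns to each seller exactly what
her virtual buyer held, and the total value becomes `SW`. -/
theorem pca_sold_le_and_LW_le_SW [Nonempty N] (A : Market N M) {v : N → ℝ≥0} {ρ : M → ℝ≥0}
    (B : N → ℝ≥0∞) {ε : ℝ≥0} (rule : ClinchRule A.withVirtual)
    (hv : ∀ i, v i ∈ posMultiples ε) (hρ : ∀ j, ρ j ∈ posMultiples ε) {a : Allocation N M}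
    (ha : a.w ∈ A.poly) :
    (∀ j, ∑ i, (pca A v ρ B ε rule).w i j ≤ A.supply j) ∧
      LW A v ρ B a ≤ SW A v ρ (pca A v ρ B ε rule) := by
  have hne : buyerOrder N M ≠ [] := by
    obtain ⟨i⟩ := ‹Nonempty N›
    exact List.ne_nil_of_mem (mem_buyerOrder (Sum.inl i))
  obtain ⟨h1, h2, h3⟩ := finalState_welfare (A := A.withVirtual) (rule := rule)
    (v := Sum.elim v ρ) (B := Sum.elim B fun _ => ⊤) (ε := ε) (by rintro (i | j); exacts [hv i, hρ j])
    mem_buyerOrder nodup_buyerOrder hne (extendVirtual_mem_poly ha) (by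
      rw [Finset.sum_comm]
      simp only [sum_extendVirtual ha, supply_withVirtual])
  obtain ⟨s, hs⟩ : ∃ s, s = pcaState A v ρ B ε rule := ⟨_, rfl⟩
  have hpca : ∀ i j, (pca A v ρ B ε rule).w i j = s.w (Sum.inl i) j := fun i j => by
    rw [hs]; rfl
  change (pcaState A v ρ B ε rule).w ∈ _ at h1
  change ∑ k, ∑ j, (pcaState A v ρ B ε rule).w k j = _ at h2
  change _ ≤ ∑ k, _ * ((∑ j, (pcaState A v ρ B ε rule).w k j : ℝ≥0) : ℝ) at h3
  rw [← hs] at h1 h2 h3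
  have hcol : ∀ j, ∑ k, s.w k j = A.supply j := by
    intro j
    rw [Finset.sum_comm] at h2
    have := (Finset.sum_eq_sum_iff_of_le fun j _ => Market.sum_le_supply h1 j).1 h2 j
      (Finset.mem_univ j)
    rwa [supply_withVirtual] at this
  have hinr : ∀ k j, k ≠ j → s.w (Sum.inr k) j = 0 := fun k j hk =>
    h1.1 _ j (by simpa [Market.withVirtual] using hk)
  have hcol' : ∀ j, ∑ i, s.w (Sum.inl i) j + s.w (Sum.inr j) j = A.supply j := by
    intro j
    rw [← hcol j, Fintype.sum_sum_type]
    congr 1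
    exact (Finset.sum_eq_single j (fun k _ hk => hinr k j hk) (by simp)).symm
  have hrow : ∀ k, ∑ j, s.w (Sum.inr k) j = s.w (Sum.inr k) k := fun k =>
    Finset.sum_eq_single k (fun j _ hj => hinr k j hj.symm) (by simp)
  refine ⟨fun j => ?_, ?_⟩
  · simp only [hpca]
    rw [← hcol' j]
    exact le_self_add
  · rw [Fintype.sum_sum_type, Fintype.sum_sum_type] at h3
    unfold LW SW
    simp only [hpca]
    refine (le_of_eq ?_).trans (h3.trans (le_of_eq ?_))
    · congr 1
      refine Finset.sum_congr rfl fun j _ => ?_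
      have e : ∑ j', extendVirtual A a.w (Sum.inr j) j' = A.supply j - ∑ i, a.w i j := by
        simp [extendVirtual]
      rw [e]
      simp only [Sum.elim_inr, le_top, inf_of_le_left, ENNReal.coe_toReal, NNReal.coe_mul]
      rw [NNReal.coe_sub (Market.sum_le_supply ha j), NNReal.coe_sum]
    · simp only [Sum.elim_inl, Sum.elim_inr, hrow, NNReal.coe_sum]
      congr 1
      refine Finset.sum_congr rfl fun j _ => ?_
      rw [← hcol' j]
      push_cast
      ring

theorem restrict_mem_poly {A : Market N M} {w : N → M → ℝ≥0} (hw : w ∈ A.poly) (S : Finset M) :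
    (fun i (j : S) => w i j) ∈ (A.restrict S).poly :=
  ⟨fun i j hij => hw.1 i j hij, fun j F hF => hw.2 j F hF⟩

theorem sum_subtype_eq_ite (S : Finset M) (g : M → ℝ) :
    ∑ j : S, g j = ∑ j, if j ∈ S then g j else 0 := by
  rw [Finset.sum_coe_sort S g]
  simp

/-- The liquid welfare that the mechanism competes with, and the number of goods it sells. -/
theorem mech_sold_le_and_welfare [Nonempty N] (A : Market N M) {v : N → ℝ≥0} {ρ σ : M → ℝ≥0}
    (B : N → ℝ≥0∞) {ε : ℝ≥0} (rule : ∀ S : Finset M, ClinchRule (A.restrict S).withVirtual)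
    (hv : ∀ i, v i ∈ posMultiples ε) (hσ : ∀ j, σ j ∈ posMultiples ε) {a : Allocation N M}
    (ha : a.w ∈ A.poly) :
    (∀ j, ∑ i, (mech A v ρ σ B ε rule).w i j ≤ A.supply j) ∧
    (∀ i j, ¬ ρ j ≤ σ j → (mech A v ρ σ B ε rule).w i j = 0) ∧
    ∑ i, (min ((v i * ∑ j, (if ρ j ≤ σ j then a.w i j else 0) : ℝ≥0) : ℝ≥0∞) (B i)).toReal +
        ∑ j, (if ρ j ≤ σ j then (σ j : ℝ) * (A.supply j - ∑ i, (a.w i j : ℝ)) else 0) ≤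
      ∑ i, (v i : ℝ) * ∑ j, ((mech A v ρ σ B ε rule).w i j : ℝ) +
        ∑ j, (if ρ j ≤ σ j then
          (σ j : ℝ) * (A.supply j - ∑ i, ((mech A v ρ σ B ε rule).w i j : ℝ)) else 0) := by
  obtain ⟨S, hS⟩ : ∃ S : Finset M, S = Finset.univ.filter fun j => ρ j ≤ σ j := ⟨_, rfl⟩
  have hSj : ∀ j, j ∈ S ↔ ρ j ≤ σ j := fun j => by simp [hS]
  have hw : ∀ i j, (mech A v ρ σ B ε rule).w i j =
      if h : j ∈ S then
        (pca (A.restrict S) v (fun j => σ j) B ε (rule S)).w i ⟨j, h⟩ else 0 := by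
    subst hS
    intro i j
    rfl
  obtain ⟨h1, h2⟩ := pca_sold_le_and_LW_le_SW (A.restrict S) (v := v) (ρ := fun j => σ j) B
    (rule S) hv (fun j => hσ j) (a := ⟨fun i j => a.w i j, a.p, fun j => a.r j⟩)
    (restrict_mem_poly ha S)
  have hw' : ∀ i (j : S), (pca (A.restrict S) v (fun j => σ j) B ε (rule S)).w i j =
      (mech A v ρ σ B ε rule).w i j := fun i j => by rw [hw, dif_pos j.2]
  have hoff : ∀ i j, ¬ ρ j ≤ σ j → (mech A v ρ σ B ε rule).w i j = 0 := fun i j h => by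
    rw [hw, dif_neg (by rwa [hSj])]
  simp only [hw'] at h1
  refine ⟨fun j => ?_, hoff, ?_⟩
  · by_cases h : ρ j ≤ σ j
    · exact h1 ⟨j, (hSj j).2 h⟩
    · simp [hoff _ j h]
  · unfold LW SW at h2
    simp only [hw'] at h2
    have hsup : ∀ j : S, (A.restrict S).supply j = A.supply j := fun _ => rfl
    simp only [hsup] at h2
    rw [sum_subtype_eq_ite S fun j => (σ j : ℝ) * (A.supply j - ∑ i, (a.w i j : ℝ)),
      sum_subtype_eq_ite S fun j =>
        (σ j : ℝ) * (A.supply j - ∑ i, ((mech A v ρ σ B ε rule).w i j : ℝ))] at h2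
    have e1 : ∀ i, ∑ j : S, ((mech A v ρ σ B ε rule).w i j : ℝ) =
        ∑ j, ((mech A v ρ σ B ε rule).w i j : ℝ) := by
      intro i
      rw [sum_subtype_eq_ite S fun j => ((mech A v ρ σ B ε rule).w i j : ℝ)]
      refine Finset.sum_congr rfl fun j _ => ?_
      split_ifs with h
      · rfl
      · rw [hSj] at h; simp [hoff i j h]
    have e2 : ∀ i, ∑ j : S, a.w i j = ∑ j, if ρ j ≤ σ j then a.w i j else 0 := by
      intro i
      rw [Finset.sum_coe_sort S (fun j => a.w i j), hS, Finset.sum_filter]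
    simp only [e1, e2, hSj] at h2
    exact h2

/-- This pays for letting each buyer use her whole budget in both runs. -/
theorem toReal_min_add_le (x y : ℝ≥0) (b : ℝ≥0∞) :
    (min ((x + y : ℝ≥0) : ℝ≥0∞) b).toReal ≤
      (min (x : ℝ≥0∞) b).toReal + (min (y : ℝ≥0∞) b).toReal := by
  have hx : min (x : ℝ≥0∞) b ≠ ⊤ := ne_top_of_le_ne_top ENNReal.coe_ne_top (min_le_left _ _)
  have hy : min (y : ℝ≥0∞) b ≠ ⊤ := ne_top_of_le_ne_top ENNReal.coe_ne_top (min_le_left _ _)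
  rw [← ENNReal.toReal_add hx hy]
  refine ENNReal.toReal_mono (ENNReal.add_ne_top.2 ⟨hx, hy⟩) ?_
  rcases le_total (x : ℝ≥0∞) b with h1 | h1
  · rcases le_total (y : ℝ≥0∞) b with h2 | h2
    · rw [min_eq_left h1, min_eq_left h2, ENNReal.coe_add]
      exact min_le_left _ _
    · rw [min_eq_right h2]
      exact (min_le_right _ _).trans le_add_self
  · rw [min_eq_right h1]
    exact (min_le_right _ _).trans le_self_add

/-- The liquid welfare of any feasible allocation, for valuations of the sellers that are at most
the larger of two profiles, is at most the sum of the social welfares of the mechanism when the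
profiles serve as valuations and as samples in both ways. -/
theorem LW_le_SW_mech_add_SW_mech [Nonempty N] (A : Market N M) {v : N → ℝ≥0}
    {ρa ρb ρ : M → ℝ≥0} (B : N → ℝ≥0∞) {ε : ℝ≥0}
    (rule : ∀ S : Finset M, ClinchRule (A.restrict S).withVirtual)
    (hv : ∀ i, v i ∈ posMultiples ε) (hρa : ∀ j, ρa j ∈ posMultiples ε)
    (hρb : ∀ j, ρb j ∈ posMultiples ε) (hρ : ∀ j, ρ j ≤ max (ρa j) (ρb j))
    {a : Allocation N M} (ha : a.w ∈ A.poly) :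
    LW A v ρ B a ≤ SW A v ρa (mech A v ρa ρb B ε rule) +
      SW A v ρb (mech A v ρb ρa B ε rule) := by
  obtain ⟨h1, h2, h3⟩ := mech_sold_le_and_welfare A (ρ := ρa) B rule hv hρb ha
  obtain ⟨g1, g2, g3⟩ := mech_sold_le_and_welfare A (ρ := ρb) B rule hv hρa ha
  obtain ⟨w₁, hw₁⟩ : ∃ w, w = (mech A v ρa ρb B ε rule).w := ⟨_, rfl⟩
  obtain ⟨w₂, hw₂⟩ : ∃ w, w = (mech A v ρb ρa B ε rule).w := ⟨_, rfl⟩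
  unfold LW SW
  simp only [← hw₁, ← hw₂] at h1 h2 h3 g1 g2 g3 ⊢
  have hmin : ∑ i, (min ((v i * ∑ j, a.w i j : ℝ≥0) : ℝ≥0∞) (B i)).toReal ≤
      ∑ i, (min ((v i * ∑ j, (if ρa j ≤ ρb j then a.w i j else 0) : ℝ≥0) : ℝ≥0∞)
          (B i)).toReal +
        ∑ i, (min ((v i * ∑ j, (if ρb j ≤ ρa j then a.w i j else 0) : ℝ≥0) : ℝ≥0∞)
          (B i)).toReal := by
    rw [← Finset.sum_add_distrib]
    refine Finset.sum_le_sum fun i _ => le_trans ?_ (toReal_min_add_le _ _ _)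
    refine ENNReal.toReal_mono
      (ne_top_of_le_ne_top ENNReal.coe_ne_top (min_le_left _ _)) (min_le_min_right _ ?_)
    rw [ENNReal.coe_le_coe, ← mul_add, ← Finset.sum_add_distrib]
    gcongr with j
    -- On a tie the edge is counted in both runs, which is harmless for an upper bound.
    rcases le_total (ρa j) (ρb j) with h | h <;> simp [h]
  have hsell : ∑ j, (ρ j : ℝ) * (A.supply j - ∑ i, (a.w i j : ℝ)) ≤
      ∑ j, (if ρa j ≤ ρb j then (ρb j : ℝ) * (A.supply j - ∑ i, (a.w i j : ℝ)) else 0) +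
        ∑ j, (if ρb j ≤ ρa j then (ρa j : ℝ) * (A.supply j - ∑ i, (a.w i j : ℝ)) else 0) := by
    rw [← Finset.sum_add_distrib]
    refine Finset.sum_le_sum fun j _ => ?_
    have hle : ∑ i, (a.w i j : ℝ) ≤ A.supply j := by exact_mod_cast Market.sum_le_supply ha j
    have hg : 0 ≤ (A.supply j : ℝ) - ∑ i, (a.w i j : ℝ) := sub_nonneg.2 hle
    have ha0 := mul_nonneg (ρa j).2 hg
    have hb0 := mul_nonneg (ρb j).2 hg
    simp only [NNReal.val_eq_coe] at ha0 hb0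
    rcases le_total (ρa j) (ρb j) with h | h
    · have h' : (ρ j : ℝ) ≤ ρb j := by exact_mod_cast (hρ j).trans (max_le h le_rfl)
      have := mul_le_mul_of_nonneg_right h' hg
      rw [if_pos h]
      split_ifs <;> linarith
    · have h' : (ρ j : ℝ) ≤ ρa j := by exact_mod_cast (hρ j).trans (max_le le_rfl h)
      have := mul_le_mul_of_nonneg_right h' hg
      rw [if_pos h]
      split_ifs <;> linarith
  -- If `ρa j < ρb j`, the goods kept in the first run are valued at `ρb j` on the left and at `ρa
  -- j` on the right. The gap is covered by the second run, where `j` is excluded and keeps her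
  -- whole supply at value `ρb j`.
  have hkeep : ∑ j, (if ρa j ≤ ρb j then
        (ρb j : ℝ) * (A.supply j - ∑ i, (w₁ i j : ℝ)) else 0) +
      ∑ j, (if ρb j ≤ ρa j then (ρa j : ℝ) * (A.supply j - ∑ i, (w₂ i j : ℝ)) else 0) ≤
      ∑ j, (ρa j : ℝ) * (A.supply j - ∑ i, (w₁ i j : ℝ)) +
        ∑ j, (ρb j : ℝ) * (A.supply j - ∑ i, (w₂ i j : ℝ)) := by
    rw [← Finset.sum_add_distrib, ← Finset.sum_add_distrib]
    refine Finset.sum_le_sum fun j _ => ?_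
    have hle₁ : ∑ i, (w₁ i j : ℝ) ≤ A.supply j := by exact_mod_cast h1 j
    have hle₂ : ∑ i, (w₂ i j : ℝ) ≤ A.supply j := by exact_mod_cast g1 j
    have hp₁ : 0 ≤ ∑ i, (w₁ i j : ℝ) := Finset.sum_nonneg fun i _ => (w₁ i j).2
    have hp₂ : 0 ≤ ∑ i, (w₂ i j : ℝ) := Finset.sum_nonneg fun i _ => (w₂ i j).2
    have ha0 : (0 : ℝ) ≤ ρa j := (ρa j).2
    have hb0 : (0 : ℝ) ≤ ρb j := (ρb j).2
    rcases lt_trichotomy (ρa j) (ρb j) with h | h | h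
    · have : ∑ i, (w₂ i j : ℝ) = 0 :=
        Finset.sum_eq_zero fun i _ => by rw [g2 i j (not_le.2 h)]; rfl
      rw [if_pos h.le, if_neg (not_le.2 h), this]
      nlinarith [mul_nonneg ha0 (sub_nonneg.2 hle₁), mul_nonneg hb0 hp₁]
    · rw [if_pos h.le, if_pos h.ge, h]
    · have : ∑ i, (w₁ i j : ℝ) = 0 :=
        Finset.sum_eq_zero fun i _ => by rw [h2 i j (not_le.2 h)]; rfl
      rw [if_neg (not_le.2 h), if_pos h.le, this]
      nlinarith [mul_nonneg hb0 (sub_nonneg.2 hle₂), mul_nonneg ha0 hp₂]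
  linarith

theorem zero_mem_feasible (A : Market N M) (B : N → ℝ≥0∞) :
    (⟨fun _ _ => 0, fun _ => 0, fun _ => 0⟩ : Allocation N M) ∈ feasible A B :=
  ⟨fun _ => by simp, fun _ _ _ => rfl, fun _ _ _ => by simp⟩

theorem LWOPT_nonneg (A : Market N M) (v : N → ℝ≥0) (ρ : M → ℝ≥0) (B : N → ℝ≥0∞) :
    0 ≤ LWOPT A v ρ B := by
  refine Real.sSup_nonneg ?_
  rintro _ ⟨a, ha, rfl⟩
  refine add_nonneg (Finset.sum_nonneg fun i _ => ENNReal.toReal_nonneg)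
    (Finset.sum_nonneg fun j _ => mul_nonneg (ρ j).2 (sub_nonneg.2 ?_))
  exact_mod_cast Market.sum_le_supply ha.2 j

/-- The right-hand side does not involve `ρ`, so `ρa` and `ρb` can both be inserted and the two
bounds averaged. -/
theorem LWOPT_le_SW_mech_add_SW_mech [Nonempty N] (A : Market N M) {v : N → ℝ≥0}
    {ρa ρb ρ : M → ℝ≥0} (B : N → ℝ≥0∞) {ε : ℝ≥0}
    (rule : ∀ S : Finset M, ClinchRule (A.restrict S).withVirtual)
    (hv : ∀ i, v i ∈ posMultiples ε) (hρa : ∀ j, ρa j ∈ posMultiples ε)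
    (hρb : ∀ j, ρb j ∈ posMultiples ε) (hρ : ∀ j, ρ j ≤ max (ρa j) (ρb j)) :
    LWOPT A v ρ B ≤ SW A v ρa (mech A v ρa ρb B ε rule) +
      SW A v ρb (mech A v ρb ρa B ε rule) := by
  refine csSup_le ⟨_, _, zero_mem_feasible A B, rfl⟩ ?_
  rintro _ ⟨a, ha, rfl⟩
  exact LW_le_SW_mech_add_SW_mech A B rule hv hρa hρb hρ ha.2

end Mechanisms

/-! ### Measurability and expectations -/

/-- The selection rule is arbitrary, so the welfare need not depend regularly on the profiles; a
countable set carrying the law makes any function almost everywhere measurable. -/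
theorem aemeasurable_of_ae_mem_countable {α β : Type*} [MeasurableSpace α]
    [MeasurableSingletonClass α] [MeasurableSpace β] [Nonempty β] {μ : MeasureTheory.Measure α}
    {s : Set α} (hs : s.Countable) (h : ∀ᵐ x ∂μ, x ∈ s) (f : α → β) : AEMeasurable f μ := by
  classical
  obtain ⟨b⟩ := ‹Nonempty β›
  refine ⟨s.piecewise f fun _ => b, fun t _ => ?_, ?_⟩
  · rw [Set.piecewise_preimage, Set.ite]
    refine (hs.mono Set.inter_subset_right).measurableSet.union ?_
    by_cases hb : b ∈ t
    · simpa [Set.preimage_const_of_mem hb, ← Set.compl_eq_univ_sdiff] using hs.measurableSet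
    · simp [Set.preimage_const_of_notMem hb]
  · filter_upwards [h] with x hx
    simp [hx]

theorem countable_posMultiples (ε : ℝ≥0) : (posMultiples ε).Countable := by
  refine (Set.countable_range fun k : ℕ => (k : ℝ≥0) * ε).mono ?_
  rintro x ⟨-, k, rfl⟩
  exact ⟨k, rfl⟩

/-- An inequality between symmetrized nonnegative parts passes to the expectations for two
independent samples. -/
theorem half_lintegral_le_of_symm {α : Type*} [MeasurableSpace α] {μ : MeasureTheory.Measure α}
    [MeasureTheory.IsProbabilityMeasure μ] {f : α → ℝ} {g : α × α → ℝ}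
    (hf : AEMeasurable f μ) (hg : AEMeasurable g (μ.prod μ)) (hf0 : ∀ x, 0 ≤ f x)
    (h : ∀ᵐ q ∂μ.prod μ, (1 / 2 : ℝ) * (f q.1 + f q.2) ≤ g q + g q.swap) :
    (1 / 2 : ℝ≥0∞) * ∫⁻ x, ENNReal.ofReal (f x) ∂μ ≤ ∫⁻ q, ENNReal.ofReal (g q) ∂μ.prod μ := by
  -- Valuations and samples have the same law, so exchanging them leaves the expectation unchanged.
  have hswap : ∫⁻ q, ENNReal.ofReal (g q.swap) ∂μ.prod μ =
      ∫⁻ q, ENNReal.ofReal (g q) ∂μ.prod μ :=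
    MeasureTheory.lintegral_prod_swap fun q => ENNReal.ofReal (g q)
  have hf' := hf.ennreal_ofReal
  have hfst : ∫⁻ q, ENNReal.ofReal (f q.1) ∂μ.prod μ = ∫⁻ x, ENNReal.ofReal (f x) ∂μ := by
    rw [MeasureTheory.lintegral_prod _ hf'.comp_fst]
    simp
  have hsnd : ∫⁻ q, ENNReal.ofReal (f q.2) ∂μ.prod μ = ∫⁻ x, ENNReal.ofReal (f x) ∂μ := by
    rw [MeasureTheory.lintegral_prod _ hf'.comp_snd]
    simp
  have hhalf : ENNReal.ofReal (1 / 2) = 2⁻¹ := by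
    rw [one_div, ENNReal.ofReal_inv_of_pos two_pos, ENNReal.ofReal_ofNat]
  have key : ∫⁻ q, 2⁻¹ * (ENNReal.ofReal (f q.1) + ENNReal.ofReal (f q.2)) ∂μ.prod μ ≤
      ∫⁻ q, (ENNReal.ofReal (g q) + ENNReal.ofReal (g q.swap)) ∂μ.prod μ := by
    refine MeasureTheory.lintegral_mono_ae ?_
    filter_upwards [h] with q hq
    rw [← ENNReal.ofReal_add (hf0 _) (hf0 _), ← hhalf, ← ENNReal.ofReal_mul (by norm_num)]
    -- Subadditivity of `ENNReal.ofReal` makes a sign condition on `g` unnecessary.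
    exact (ENNReal.ofReal_le_ofReal hq).trans ENNReal.ofReal_add_le
  rw [MeasureTheory.lintegral_const_mul' _ _ (by simp),
    MeasureTheory.lintegral_add_left' hf'.comp_fst,
    MeasureTheory.lintegral_add_left' hg.ennreal_ofReal, hswap, hfst, hsnd, ← two_mul, ← two_mul,
    ← mul_assoc, ENNReal.inv_mul_cancel two_ne_zero (by simp), one_mul] at key
  calc (1 / 2 : ℝ≥0∞) * ∫⁻ x, ENNReal.ofReal (f x) ∂μ
      ≤ (1 / 2) * (2 * ∫⁻ q, ENNReal.ofReal (g q) ∂μ.prod μ) := by gcongr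
    _ = _ := by
      rw [one_div, ← mul_assoc, ENNReal.inv_mul_cancel two_ne_zero (by simp), one_mul]

end TwoSided

end

theorem corollary4p6 {n m : ℕ} (hn : 0 < n) (hm : 0 < m)
    (A : TwoSided.Market (Fin n) (Fin m))
    (ε : ℝ≥0) (hε : 0 < ε)
    (v : Fin n → ℝ≥0) (hv : ∀ i, v i ∈ TwoSided.posMultiples ε)
    (B : Fin n → ℝ≥0∞)
    (rule : ∀ S : Finset (Fin m), TwoSided.ClinchRule (A.restrict S).withVirtual) :
    (∀ ρa ρb : Fin m → ℝ≥0,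
      (∀ j, ρa j ∈ TwoSided.posMultiples ε) → (∀ j, ρb j ∈ TwoSided.posMultiples ε) →
      (1 / 2 : ℝ) * (TwoSided.LWOPT A v ρa B + TwoSided.LWOPT A v ρb B) ≤
        TwoSided.SW A v ρa (TwoSided.mech A v ρa ρb B ε rule) +
        TwoSided.SW A v ρb (TwoSided.mech A v ρb ρa B ε rule)) ∧
    (∀ G : Fin m → MeasureTheory.Measure ℝ≥0,
      (∀ j, MeasureTheory.IsProbabilityMeasure (G j)) →
      (∀ j, ∀ᵐ x ∂(G j), x ∈ TwoSided.posMultiples ε) →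
      AEMeasurable (fun ρ => TwoSided.LWOPT A v ρ B) (MeasureTheory.Measure.pi G) ∧
      AEMeasurable
        (fun q : (Fin m → ℝ≥0) × (Fin m → ℝ≥0) =>
          TwoSided.SW A v q.1 (TwoSided.mech A v q.1 q.2 B ε rule))
        ((MeasureTheory.Measure.pi G).prod (MeasureTheory.Measure.pi G)) ∧
      (1 / 2 : ℝ≥0∞) *
          ∫⁻ ρ, ENNReal.ofReal (TwoSided.LWOPT A v ρ B) ∂(MeasureTheory.Measure.pi G) ≤
        ∫⁻ q : (Fin m → ℝ≥0) × (Fin m → ℝ≥0),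
          ENNReal.ofReal (TwoSided.SW A v q.1 (TwoSided.mech A v q.1 q.2 B ε rule))
          ∂((MeasureTheory.Measure.pi G).prod (MeasureTheory.Measure.pi G))) := by
  have : Nonempty (Fin n) := ⟨⟨0, hn⟩⟩
  have ha : ∀ ρa ρb : Fin m → ℝ≥0,
      (∀ j, ρa j ∈ TwoSided.posMultiples ε) → (∀ j, ρb j ∈ TwoSided.posMultiples ε) →
      (1 / 2 : ℝ) * (TwoSided.LWOPT A v ρa B + TwoSided.LWOPT A v ρb B) ≤
        TwoSided.SW A v ρa (TwoSided.mech A v ρa ρb B ε rule) +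
        TwoSided.SW A v ρb (TwoSided.mech A v ρb ρa B ε rule) := by
    intro ρa ρb hρa hρb
    have h1 := TwoSided.LWOPT_le_SW_mech_add_SW_mech A B rule hv hρa hρb
      (fun j => le_max_left _ _)
    have h2 := TwoSided.LWOPT_le_SW_mech_add_SW_mech A B rule hv hρa hρb
      (fun j => le_max_right _ _)
    linarith
  refine ⟨ha, fun G hG hsupp => ?_⟩
  have hae : ∀ᵐ ρ ∂MeasureTheory.Measure.pi G,
      ρ ∈ {ρ : Fin m → ℝ≥0 | ∀ j, ρ j ∈ TwoSided.posMultiples ε} :=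
    MeasureTheory.ae_all_iff.2 fun j => MeasureTheory.Measure.tendsto_eval_ae_ae (hsupp j)
  have hcount : {ρ : Fin m → ℝ≥0 | ∀ j, ρ j ∈ TwoSided.posMultiples ε}.Countable := by
    have := Set.countable_univ_pi fun _ : Fin m => TwoSided.countable_posMultiples ε
    simpa [Set.pi] using this
  have hae₂ : ∀ᵐ q ∂(MeasureTheory.Measure.pi G).prod (MeasureTheory.Measure.pi G),
      q ∈ {ρ : Fin m → ℝ≥0 | ∀ j, ρ j ∈ TwoSided.posMultiples ε} ×ˢ
        {ρ : Fin m → ℝ≥0 | ∀ j, ρ j ∈ TwoSided.posMultiples ε} := by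
    filter_upwards [MeasureTheory.Measure.quasiMeasurePreserving_fst.ae hae,
      MeasureTheory.Measure.quasiMeasurePreserving_snd.ae hae] with q h1 h2
    exact ⟨h1, h2⟩
  have hL := TwoSided.aemeasurable_of_ae_mem_countable hcount hae
    fun ρ => TwoSided.LWOPT A v ρ B
  have hS := TwoSided.aemeasurable_of_ae_mem_countable (hcount.prod hcount) hae₂
    fun q : (Fin m → ℝ≥0) × (Fin m → ℝ≥0) =>
      TwoSided.SW A v q.1 (TwoSided.mech A v q.1 q.2 B ε rule)
  refine ⟨hL, hS, TwoSided.half_lintegral_le_of_symm hL hS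
    (fun ρ => TwoSided.LWOPT_nonneg A v ρ B) ?_⟩
  filter_upwards [hae₂] with q hq
  exact ha q.1 q.2 hq.1 hq.2
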